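/- Let $a_1,a_2,b,c_1,\dots,c_4$ be complex numbers of absolute value $1$ such that $1,a_1,a_2$ are pairwise distinct, $b\neq 1$, and $c_1,\dots,c_4$ are pairwise distinct. Let $T_0,T_1,T_\infty\in\mathrm{GL}_4(\mathbb{C})$ be diagonalizable matrices with $T_0T_1T_\infty=I_4$ whose eigenvalues, with multiplicity, are $(1,1,a_1,a_2)$, $(1,1,b,b)$ and $(c_1,c_2,c_3,c_4)$ respectively (a G-II system), and suppose that the group they generate acts irreducibly on $\mathbb{C}^4$. Then there is a nonzero Hermitian matrix $H$ with $T_s^*HT_s=H$ for $s=0,1,\infty$, and it is unique up to a real scalar factor. Let $\mathcal{I}_1$ be either of the two open arcs of the unit circle with end points $1$ and $b^{-1}$, and let $\mathcal{I}_2$ be that one of the two open arcs of the unit circle with end points $b^{-1}a_1^{-1}$ and $b^{-1}a_2^{-1}$ which contains $b^{-1}$. Then $H$ is (positive or negative) definite if and only if, for some labelling $c_1,\dots,c_4$ of the eigenvalues of $T_\infty$, \begin{align*} &\text{(i)}\quad c_1,c_2\in\mathcal{I}_1,\quad c_3,c_4\notin\mathcal{I}_1,\\ &\text{(ii)}\quad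 c_1c_2,\;c_3c_4,\;c_1c_3,\;c_2c_4\in\mathcal{I}_2,\quad c_1c_4,\;c_2c_3\notin\mathcal{I}_2. \end{align*} -/

import Mathlib

open scoped ComplexOrder

/-- The open arc of the unit circle traversed counterclockwise from `p` to `q`
(both end points excluded). -/
def ccwArc (p q : Circle) : Set Circle :=
  {z | ∃ s t : ℝ, 0 < s ∧ s < t ∧ t < 2 * Real.pi ∧
    z = p * Circle.exp s ∧ q = p * Circle.exp t}

/-- `I` is one of the two open arcs of the unit circle with end points `p` and `q`. -/
def IsOpenArc (p q : Circle) (I : Set Circle) : Prop :=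
  I = ccwArc p q ∨ I = ccwArc q p

/-- `T` is diagonalizable and `d` lists its eigenvalues with multiplicity. -/
def HasSemisimpleSpectrum (T : Matrix (Fin 4) (Fin 4) ℂ) (d : Fin 4 → Circle) : Prop :=
  ∃ P : GL (Fin 4) ℂ,
    T = (P : Matrix (Fin 4) (Fin 4) ℂ) * Matrix.diagonal (fun i => (d i : ℂ)) *
      ((P⁻¹ : GL (Fin 4) ℂ) : Matrix (Fin 4) (Fin 4) ℂ)

/-- `(T₀, T₁, T∞)` is the triple of local monodromies of a G-II system: the matrices are
diagonalizable with product `1` and spectra `(1, 1, a₁, a₂)`, `(1, 1, b, b)` and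
`(c₁, c₂, c₃, c₄)`, of multiplicities `2 1²`, `2²` and `1⁴`, on the unit circle. -/
structure IsGII (a₁ a₂ b : Circle) (c : Fin 4 → Circle)
    (T₀ T₁ Tinf : Matrix (Fin 4) (Fin 4) ℂ) : Prop where
  a₁_ne_one : a₁ ≠ 1
  a₂_ne_one : a₂ ≠ 1
  a₁_ne_a₂ : a₁ ≠ a₂
  b_ne_one : b ≠ 1
  c_injective : Function.Injective c
  spectrum_zero : HasSemisimpleSpectrum T₀ ![1, 1, a₁, a₂]
  spectrum_one : HasSemisimpleSpectrum T₁ ![1, 1, b, b]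
  spectrum_inf : HasSemisimpleSpectrum Tinf c
  prod_eq_one : T₀ * T₁ * Tinf = 1

/-- The triple acts irreducibly on `ℂ⁴`: there is no invariant subspace besides `0` and `ℂ⁴`. -/
def IsIrreducibleTriple (T₀ T₁ Tinf : Matrix (Fin 4) (Fin 4) ℂ) : Prop :=
  ∀ W : Submodule ℂ (Fin 4 → ℂ),
    (∀ v ∈ W, T₀.mulVec v ∈ W ∧ T₁.mulVec v ∈ W ∧ Tinf.mulVec v ∈ W) → W = ⊥ ∨ W = ⊤

/-- `H` is (the matrix of) a Hermitian form invariant under the triple. -/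
structure IsInvariantHermitian (T₀ T₁ Tinf H : Matrix (Fin 4) (Fin 4) ℂ) : Prop where
  isHermitian : H.IsHermitian
  inv_zero : T₀.conjTranspose * H * T₀ = H
  inv_one : T₁.conjTranspose * H * T₁ = H
  inv_inf : Tinf.conjTranspose * H * Tinf = H

/-- A Hermitian matrix is definite if it is positive definite or negative definite. -/
def IsDefinite (H : Matrix (Fin 4) (Fin 4) ℂ) : Prop :=
  H.PosDef ∨ (-H).PosDef

/-- The condition on a labelling `(c 0, c 1, c 2, c 3) = (c₁, c₂, c₃, c₄)` of the eigenvalues. -/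
def ArcCondition (I₁ I₂ : Set Circle) (c : Fin 4 → Circle) : Prop :=
  (c 0 ∈ I₁ ∧ c 1 ∈ I₁ ∧ c 2 ∉ I₁ ∧ c 3 ∉ I₁) ∧
  (c 0 * c 1 ∈ I₂ ∧ c 2 * c 3 ∈ I₂ ∧ c 0 * c 2 ∈ I₂ ∧ c 1 * c 3 ∈ I₂ ∧
    c 0 * c 3 ∉ I₂ ∧ c 1 * c 2 ∉ I₂)

/-!
# Definiteness of the invariant Hermitian form of a G-II system

Existence of `H` is rigidity: the centralizers of `T₀`, `T₁`, `Tinf` have dimensions `6`, `8`, `4`,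
which add up to more than `16`, so Scott's lemma (`exists_fixed_or_fixed_dual`) on the space of
sesquilinear forms yields a fixed form or a fixed functional, and the latter is the inverse of a
fixed form. Uniqueness is Schur's lemma. Scott's lemma on `ℂ⁴` also shows that no eigenvalue of
`Tinf` is `1` or `b⁻¹`.

For definiteness, choose an eigenbasis of `Tinf`. There `H` is a real diagonal matrix and
`T₁ = 1 + (b - 1) Q` with a projection `Q` of rank two that is self-adjoint for `H`
(`IsGII.exists_normalForm`). The principal `2 × 2` minors `eᵢⱼ` of `Q` are real, and `hᵢ hⱼ eᵢⱼ` is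
an absolute square times the determinant of `H` on the image of `Q`. Irreducibility makes the
minors nonzero, so `H` is definite if and only if all of them are positive (`IsGII.exists_minors`).

The minors can be computed. Let `vᵢ` be the cotangent coordinate of `cᵢ`, normalized to vanish at
`b⁻¹`; its sign tells whether `cᵢ` lies in `I₁`. That `T₀` has a two-dimensional fixed space says
that the compression of `diag v` to the image of `Q` vanishes. Hence `∑ⱼ eᵢⱼ vⱼ = 0` for each `i`,
and the weighted minors `eᵢⱼ vᵢ vⱼ` agree on complementary pairs (`opposite_minors_eq`). The three
remaining unknowns satisfy a Vandermonde system in the roots `dᵢ dⱼ + dₖ dₗ` of the cubic resolvent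
of the eigenvalues `dᵢ = cᵢ⁻¹` of `Tinf⁻¹`, whose right-hand sides come from `tr Q = 2` and from
`tr T₀ = 2 + a₁ + a₂` (`resolvent_moments`). The solution has as its numerators
`dᵢ dⱼ + dₖ dₗ - b (a₁ + a₂)`. Up to a constant this is the real number that is positive or negative
according to the arc between `b⁻¹ a₁⁻¹` and `b⁻¹ a₂⁻¹` on which `cᵢ cⱼ` lies (`orient_mul_eq`).
A further moment relates the constant to the sign at the point `b⁻¹`, which marks `I₂`.

It remains to compare signs. If all minors are positive and the `vᵢ` are in increasing order, the
linear relations force `v₀, v₁ < 0 < v₂, v₃`, and the formulas give the conditions on the products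
(`signs_of_minors_pos`). Conversely, the conditions force all minors to have the same sign
(`minors_same_sign`), which is positive because the minors add up to `1`.
-/

/-! ### Scott's lemma and invariant forms -/

section InvariantForms

open Matrix Module

/-- **Scott's lemma**: three automorphisms with product `1` whose fixed spaces have total dimension
greater than `dim X` have a common fixed vector or a common fixed functional. Without a fixed
functional the images of `f - 1`, `g - 1`, `h - 1` span `X`, which bounds the sum of their ranks
below by `2 dim X` as soon as there is no fixed vector either. -/
theorem exists_fixed_or_fixed_dual {X : Type*} [AddCommGroup X] [Module ℂ X]
    [FiniteDimensional ℂ X] (f g h : X →ₗ[ℂ] X) (hprod : ∀ x, f (g (h x)) = x)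
    (hdim : finrank ℂ X < finrank ℂ (LinearMap.ker (f - 1)) + finrank ℂ (LinearMap.ker (g - 1)) +
      finrank ℂ (LinearMap.ker (h - 1))) :
    (∃ x ≠ 0, f x = x ∧ g x = x ∧ h x = x) ∨
      ∃ φ : Dual ℂ X, φ ≠ 0 ∧ ∀ x, φ (f x) = φ x ∧ φ (g x) = φ x ∧ φ (h x) = φ x := by
  by_cases hr : LinearMap.range (f - 1) ⊔ (LinearMap.range (g - 1) ⊔ LinearMap.range (h - 1)) = ⊤
  · left
    by_contra hne
    push Not at hne
    -- The differential `x ↦ ((f - 1) g h x, (g - 1) h x, (h - 1) x)`, followed by the sum map,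
    -- telescopes to `f g h - 1 = 0`.
    let α : X →ₗ[ℂ] LinearMap.range (f - 1) × LinearMap.range (g - 1) × LinearMap.range (h - 1) :=
      ((f - 1).rangeRestrict ∘ₗ g ∘ₗ h).prod
        (((g - 1).rangeRestrict ∘ₗ h).prod (h - 1).rangeRestrict)
    let β : (LinearMap.range (f - 1) × LinearMap.range (g - 1) × LinearMap.range (h - 1)) →ₗ[ℂ] X :=
      (LinearMap.range (f - 1)).subtype.coprod
        ((LinearMap.range (g - 1)).subtype.coprod (LinearMap.range (h - 1)).subtype)
    have hα : Function.Injective α := by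
      rw [← LinearMap.ker_eq_bot, LinearMap.ker_eq_bot']
      intro x hx
      by_contra hx0
      have h1 : f (g (h x)) - g (h x) = 0 := congrArg (fun p => (p.1 : X)) hx
      have h2 : g (h x) - h x = 0 := congrArg (fun p => (p.2.1 : X)) hx
      have h3 : h x - x = 0 := congrArg (fun p => (p.2.2 : X)) hx
      rw [sub_eq_zero] at h1 h2 h3
      rw [h3] at h2
      rw [h3, h2] at h1
      exact hne x hx0 h1 h2 h3
    have hle : LinearMap.range α ≤ LinearMap.ker β := by
      rintro _ ⟨x, rfl⟩
      rw [LinearMap.mem_ker]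
      change (f (g (h x)) - g (h x)) + ((g (h x) - h x) + (h x - x)) = 0
      rw [hprod]
      abel
    have hβ : LinearMap.range β = ⊤ := by
      simp only [β, LinearMap.range_coprod, Submodule.range_subtype]
      exact hr
    have e1 := LinearMap.finrank_range_add_finrank_ker β
    have e2 := Submodule.finrank_mono hle
    rw [LinearMap.finrank_range_of_inj hα] at e2
    rw [hβ, finrank_top, Module.finrank_prod, Module.finrank_prod] at e1
    have ef := LinearMap.finrank_range_add_finrank_ker (f - 1)
    have eg := LinearMap.finrank_range_add_finrank_ker (g - 1)
    have eh := LinearMap.finrank_range_add_finrank_ker (h - 1)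
    omega
  · right
    obtain ⟨φ, hφ, hker⟩ := Submodule.exists_le_ker_of_lt_top _ (lt_top_iff_ne_top.mpr hr)
    refine ⟨φ, hφ, fun x => ⟨?_, ?_, ?_⟩⟩
    · have := hker (Submodule.mem_sup_left ⟨x, rfl⟩)
      rwa [LinearMap.mem_ker, LinearMap.sub_apply, map_sub, sub_eq_zero] at this
    · have := hker (Submodule.mem_sup_right (Submodule.mem_sup_left ⟨x, rfl⟩))
      rwa [LinearMap.mem_ker, LinearMap.sub_apply, map_sub, sub_eq_zero] at this
    · have := hker (Submodule.mem_sup_right (Submodule.mem_sup_right ⟨x, rfl⟩))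
      rwa [LinearMap.mem_ker, LinearMap.sub_apply, map_sub, sub_eq_zero] at this

theorem le_finrank_ker_sub_one {X : Type*} [AddCommGroup X] [Module ℂ X] [FiniteDimensional ℂ X]
    (f : X →ₗ[ℂ] X) {n : ℕ} (v : Fin n → X) (hv : LinearIndependent ℂ v)
    (hfix : ∀ i, f (v i) = v i) : n ≤ finrank ℂ (LinearMap.ker (f - 1)) := by
  have hmem : ∀ i, v i ∈ LinearMap.ker (f - 1) := fun i => by
    simp [LinearMap.mem_ker, hfix i]
  have hli : LinearIndependent ℂ (fun i => (⟨v i, hmem i⟩ : LinearMap.ker (f - 1))) :=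
    LinearIndependent.of_comp (LinearMap.ker (f - 1)).subtype hv
  simpa using hli.fintype_card_le_finrank

variable {T T₀ T₁ Tinf : Matrix (Fin 4) (Fin 4) ℂ}

/-- The columns of a diagonalizing matrix whose eigenvalue is `μ⁻¹` are fixed by `μ • T`. -/
theorem HasSemisimpleSpectrum.le_finrank_fixed {d : Fin 4 → Circle}
    (hT : HasSemisimpleSpectrum T d) (μ : ℂ) {n : ℕ} (ι : Fin n → Fin 4)
    (hι : Function.Injective ι) (hd : ∀ k, μ * d (ι k) = 1) :
    n ≤ finrank ℂ (LinearMap.ker ((μ • T).mulVecLin - 1)) := by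
  obtain ⟨P, rfl⟩ := hT
  refine le_finrank_ker_sub_one _ (fun k => (P : Matrix (Fin 4) (Fin 4) ℂ).col (ι k)) ?_ ?_
  · exact (Matrix.linearIndependent_cols_iff_isUnit.mpr P.isUnit).comp ι hι
  · intro k
    have hP : ((P⁻¹ : GL (Fin 4) ℂ) : Matrix (Fin 4) (Fin 4) ℂ) * P = 1 := by
      rw [← Units.val_mul, inv_mul_cancel, Units.val_one]
    have h1 : (P : Matrix (Fin 4) (Fin 4) ℂ) * Matrix.diagonal (fun i => (d i : ℂ)) *
        ((P⁻¹ : GL (Fin 4) ℂ) : Matrix (Fin 4) (Fin 4) ℂ) * P =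
        P * Matrix.diagonal (fun i => (d i : ℂ)) := by
      rw [Matrix.mul_assoc, hP, Matrix.mul_one]
    have h2 : Pi.single (ι k) (d (ι k) : ℂ) = (d (ι k) : ℂ) • Pi.single (ι k) (1 : ℂ) := by
      rw [← Pi.single_smul, smul_eq_mul, mul_one]
    rw [← Matrix.mulVec_single_one, Matrix.mulVecLin_apply, Matrix.smul_mulVec,
      Matrix.mulVec_mulVec, h1, ← Matrix.mulVec_mulVec, Matrix.diagonal_mulVec_single, mul_one, h2,
      Matrix.mulVec_smul, smul_smul, hd, one_smul]

/-- The action `X ↦ Tᴴ X T` of `T` on sesquilinear forms, given by their matrices. -/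
def formAction (T : Matrix (Fin 4) (Fin 4) ℂ) :
    Matrix (Fin 4) (Fin 4) ℂ →ₗ[ℂ] Matrix (Fin 4) (Fin 4) ℂ :=
  LinearMap.mulLeft ℂ Tᴴ ∘ₗ LinearMap.mulRight ℂ T

theorem formAction_apply (T X : Matrix (Fin 4) (Fin 4) ℂ) : formAction T X = Tᴴ * X * T := by
  simp [formAction, Matrix.mul_assoc]

/-- The forms `P⁻ᴴ Eᵢⱼ P⁻¹` with `dᵢ = dⱼ` are fixed, where `P` diagonalizes `T`. -/
theorem HasSemisimpleSpectrum.le_finrank_fixed_forms {d : Fin 4 → Circle}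
    (hT : HasSemisimpleSpectrum T d) {n : ℕ} (ι : Fin n → Fin 4 × Fin 4)
    (hι : Function.Injective ι) (hd : ∀ k, d (ι k).1 = d (ι k).2) :
    n ≤ finrank ℂ (LinearMap.ker (formAction T - 1)) := by
  obtain ⟨P, rfl⟩ := hT
  set R : Matrix (Fin 4) (Fin 4) ℂ := ((P⁻¹ : GL (Fin 4) ℂ) : Matrix (Fin 4) (Fin 4) ℂ) with hR
  have hP : R * P = 1 := by
    rw [hR, ← Units.val_mul, inv_mul_cancel, Units.val_one]
  have hP' : (P : Matrix (Fin 4) (Fin 4) ℂ)ᴴ * Rᴴ = 1 := by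
    rw [← Matrix.conjTranspose_mul, hP, Matrix.conjTranspose_one]
  refine le_finrank_ker_sub_one _ (fun k => formAction R (Matrix.single (ι k).1 (ι k).2 1)) ?_ ?_
  · have hinj : Function.Injective (formAction R) := by
      intro X Y hXY
      have := congrArg (formAction (P : Matrix (Fin 4) (Fin 4) ℂ)) hXY
      simpa only [formAction_apply, Matrix.mul_assoc, hP, Matrix.mul_one,
        ← Matrix.mul_assoc _ Rᴴ, hP', Matrix.one_mul] using this
    have h1 : LinearIndependent ℂ
        (fun k => Matrix.single (ι k).1 (ι k).2 (1 : ℂ)) := by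
      have := (Matrix.stdBasis ℂ (Fin 4) (Fin 4)).linearIndependent.comp ι hι
      convert this using 2 with k
      rw [Function.comp_apply, ← Matrix.stdBasis_eq_single]
    exact h1.map' _ (LinearMap.ker_eq_bot.mpr hinj)
  · intro k
    have key : (Matrix.diagonal fun i => (d i : ℂ))ᴴ * Matrix.single (ι k).1 (ι k).2 1 *
        Matrix.diagonal (fun i => (d i : ℂ)) = Matrix.single (ι k).1 (ι k).2 1 := by
      rw [Matrix.diagonal_conjTranspose]
      ext i j
      rw [Matrix.mul_diagonal, Matrix.diagonal_mul]
      by_cases hij : (ι k).1 = i ∧ (ι k).2 = j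
      · obtain ⟨rfl, rfl⟩ := hij
        rw [Matrix.single_apply_same, mul_one, ← hd k]
        simp [← Complex.normSq_eq_conj_mul_self]
      · rw [Matrix.single_apply_of_ne (h := hij)]
        ring
    simp only [formAction_apply, Matrix.conjTranspose_mul, Matrix.mul_assoc]
    simp only [← Matrix.mul_assoc _ Rᴴ, hP', ← Matrix.mul_assoc R, hP, Matrix.one_mul]
    rw [← Matrix.mul_assoc (Matrix.diagonal _)ᴴ, ← Matrix.mul_assoc _ _ R, key]

/-- An eigenvalue `μ` of `Tinf` with `μ⁻¹` a double eigenvalue of `T₁` would give the triple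
`T₀`, `μ T₁`, `μ⁻¹ Tinf` fixed spaces of total dimension `2 + 2 + 1 > 4`; by Scott's lemma it would
then have an invariant line or an invariant hyperplane. -/
theorem IsIrreducibleTriple.spectrum_ne (hirr : IsIrreducibleTriple T₀ T₁ Tinf)
    (hprod : T₀ * T₁ * Tinf = 1) {d₀ d₁ c : Fin 4 → Circle} (h₀ : HasSemisimpleSpectrum T₀ d₀)
    (h₁ : HasSemisimpleSpectrum T₁ d₁) (hinf : HasSemisimpleSpectrum Tinf c) {μ : ℂ}
    (h0 : d₀ 0 = 1 ∧ d₀ 1 = 1) {i j k : Fin 4} (hij : i ≠ j)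
    (h1 : μ * d₁ i = 1 ∧ μ * d₁ j = 1) : (c k : ℂ) ≠ μ := by
  intro hck
  have hμ : μ ≠ 0 := by
    rintro rfl
    simp at hck
  have hck' : μ⁻¹ * c k = 1 := by rw [hck, inv_mul_cancel₀ hμ]
  have f0 := h₀.le_finrank_fixed 1 ![0, 1] (by decide) (fun k => by
    fin_cases k <;> simp [h0])
  have f1 := h₁.le_finrank_fixed μ ![i, j] (by
    intro x y hxy
    fin_cases x <;> fin_cases y <;> simp_all) (fun k => by
    fin_cases k <;> simp [h1])
  have f2 := hinf.le_finrank_fixed μ⁻¹ ![k] (Function.injective_of_subsingleton _) (fun x => by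
    fin_cases x; simpa using hck')
  have hinv : ∀ x : Fin 4 → ℂ, T₀ *ᵥ (T₁ *ᵥ (Tinf *ᵥ x)) = x := by
    intro x
    rw [Matrix.mulVec_mulVec, Matrix.mulVec_mulVec, hprod, Matrix.one_mulVec]
  rcases exists_fixed_or_fixed_dual ((1 : ℂ) • T₀).mulVecLin (μ • T₁).mulVecLin
    (μ⁻¹ • Tinf).mulVecLin (fun x => by
      simp only [Matrix.mulVecLin_apply, Matrix.smul_mulVec, Matrix.mulVec_smul, smul_smul, hinv]
      rw [show μ⁻¹ * μ * 1 = 1 by field_simp, one_smul]) (by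
      rw [Module.finrank_fin_fun]; omega) with ⟨x, hx, e0, e1, e2⟩ | ⟨φ, hφ, h⟩
  · simp only [Matrix.mulVecLin_apply, Matrix.smul_mulVec, one_smul] at e0 e1 e2
    rw [← eq_inv_smul_iff₀ hμ] at e1
    rw [inv_smul_eq_iff₀ hμ] at e2
    have hd := finrank_span_singleton (K := ℂ) hx
    rcases hirr (ℂ ∙ x) (by
      intro v hv
      obtain ⟨a, rfl⟩ := Submodule.mem_span_singleton.mp hv
      simp only [Matrix.mulVec_smul, e0, e1, e2]
      have hxx := Submodule.mem_span_singleton_self (R := ℂ) x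
      exact ⟨Submodule.smul_mem _ _ hxx, Submodule.smul_mem _ _ (Submodule.smul_mem _ _ hxx),
        Submodule.smul_mem _ _ (Submodule.smul_mem _ _ hxx)⟩) with h | h
    · rw [h] at hd; simp at hd
    · rw [h, finrank_top, Module.finrank_fin_fun] at hd; omega
  · replace h : ∀ v, φ (T₀ *ᵥ v) = φ v ∧ μ * φ (T₁ *ᵥ v) = φ v ∧ μ⁻¹ * φ (Tinf *ᵥ v) = φ v := by
      intro v
      have := h v
      rwa [Matrix.mulVecLin_apply, Matrix.mulVecLin_apply, Matrix.mulVecLin_apply,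
        Matrix.smul_mulVec, Matrix.smul_mulVec, Matrix.smul_mulVec, one_smul, map_smul,
        map_smul] at this
    rcases hirr (LinearMap.ker φ) (by
      intro v hv
      rw [LinearMap.mem_ker] at hv
      obtain ⟨e0, e1, e2⟩ := h v
      simp only [hv, mul_eq_zero, hμ, inv_eq_zero, false_or] at e0 e1 e2
      exact ⟨e0, e1, e2⟩) with h | h
    · have hr := LinearMap.finrank_range_add_finrank_ker φ
      have hr' := Submodule.finrank_le (LinearMap.range φ)
      rw [h, finrank_bot, Module.finrank_fin_fun] at hr
      rw [Module.finrank_self] at hr'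
      omega
    · exact hφ (LinearMap.ker_eq_top.mp h)

/-- Schur's lemma for sesquilinear forms: the kernel of an invariant form is an invariant
subspace. -/
theorem IsIrreducibleTriple.form_eq_zero_of_mulVec_eq_zero (hirr : IsIrreducibleTriple T₀ T₁ Tinf)
    (hprod : T₀ * T₁ * Tinf = 1) {K : Matrix (Fin 4) (Fin 4) ℂ} (h0 : T₀ᴴ * K * T₀ = K)
    (h1 : T₁ᴴ * K * T₁ = K) (h2 : Tinfᴴ * K * Tinf = K) {x : Fin 4 → ℂ} (hx : x ≠ 0)
    (hKx : K *ᵥ x = 0) : K = 0 := by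
  have hdet : T₀.det * T₁.det * Tinf.det = 1 := by
    rw [← Matrix.det_mul, ← Matrix.det_mul, hprod, Matrix.det_one]
  have step : ∀ T : Matrix (Fin 4) (Fin 4) ℂ, T.det ≠ 0 → Tᴴ * K * T = K → ∀ v, K *ᵥ v = 0 →
      K *ᵥ (T *ᵥ v) = 0 := by
    intro T hT hK v hv
    have hT' : Tᴴ.det ≠ 0 := by
      rw [Matrix.det_conjTranspose]
      simpa using hT
    by_contra hne
    refine hT' (Matrix.exists_mulVec_eq_zero_iff.mp ⟨_, hne, ?_⟩)
    rw [Matrix.mulVec_mulVec, Matrix.mulVec_mulVec, hK, hv]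
  have n0 : T₀.det ≠ 0 := fun h => by simp [h] at hdet
  have n1 : T₁.det ≠ 0 := fun h => by simp [h] at hdet
  have n2 : Tinf.det ≠ 0 := fun h => by simp [h] at hdet
  rcases hirr (LinearMap.ker K.mulVecLin) (by
    intro v hv
    rw [LinearMap.mem_ker, Matrix.mulVecLin_apply] at hv
    exact ⟨step _ n0 h0 v hv, step _ n1 h1 v hv, step _ n2 h2 v hv⟩) with h | h
  · have : x ∈ LinearMap.ker K.mulVecLin := hKx
    rw [h, Submodule.mem_bot] at this
    exact absurd this hx
  · rw [LinearMap.ker_eq_top] at h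
    ext i j
    have := congrFun (congrArg (fun f : (Fin 4 → ℂ) →ₗ[ℂ] (Fin 4 → ℂ) => f (Pi.single j 1)) h) i
    simpa using this

/-- The triple and its contragredient conjugate have the same local spectra, so Scott's lemma on
the sixteen-dimensional space of sesquilinear forms yields an invariant form: the centralizers of
the three matrices have dimensions `6`, `8`, `4`, and `6 + 8 + 4 > 16`. -/
theorem IsGII.exists_form {a₁ a₂ b : Circle} {c : Fin 4 → Circle}
    (hT : IsGII a₁ a₂ b c T₀ T₁ Tinf) (hirr : IsIrreducibleTriple T₀ T₁ Tinf) :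
    ∃ K : Matrix (Fin 4) (Fin 4) ℂ, K ≠ 0 ∧ T₀ᴴ * K * T₀ = K ∧ T₁ᴴ * K * T₁ = K ∧
      Tinfᴴ * K * Tinf = K := by
  have hprod := hT.prod_eq_one
  have hdet : T₀.det * T₁.det * Tinf.det = 1 := by
    rw [← Matrix.det_mul, ← Matrix.det_mul, hprod, Matrix.det_one]
  have n0 : T₀.det ≠ 0 := fun h => by simp [h] at hdet
  have n1 : T₁.det ≠ 0 := fun h => by simp [h] at hdet
  have n2 : Tinf.det ≠ 0 := fun h => by simp [h] at hdet
  have f0 := hT.spectrum_zero.le_finrank_fixed_forms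
    ![(0, 0), (0, 1), (1, 0), (1, 1), (2, 2), (3, 3)] (by decide)
    (fun k => by fin_cases k <;> simp)
  have f1 := hT.spectrum_one.le_finrank_fixed_forms
    ![(0, 0), (0, 1), (1, 0), (1, 1), (2, 2), (2, 3), (3, 2), (3, 3)] (by decide)
    (fun k => by fin_cases k <;> simp)
  have f2 := hT.spectrum_inf.le_finrank_fixed_forms
    ![(0, 0), (1, 1), (2, 2), (3, 3)] (by decide)
    (fun k => by fin_cases k <;> simp)
  rcases exists_fixed_or_fixed_dual (formAction Tinf) (formAction T₁) (formAction T₀) (fun X => by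
      simp only [formAction_apply]
      calc _ = (T₀ * T₁ * Tinf)ᴴ * X * (T₀ * T₁ * Tinf) := by
            simp only [Matrix.conjTranspose_mul, Matrix.mul_assoc]
        _ = X := by rw [hprod]; simp) (by
      rw [Module.finrank_matrix]; simp; omega) with ⟨K, hK, e0, e1, e2⟩ | ⟨φ, hφ, h⟩
  · simp only [formAction_apply] at e0 e1 e2
    exact ⟨K, hK, e2, e1, e0⟩
  · -- A fixed functional is `X ↦ tr (Z X)` with `T Z Tᴴ = Z`; the form is `Z⁻¹`.
    simp only [formAction_apply] at h
    let ψ : Matrix (Fin 4) (Fin 4) ℂ →ₗ[ℂ] Dual ℂ (Matrix (Fin 4) (Fin 4) ℂ) :=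
      (LinearMap.mul ℂ (Matrix (Fin 4) (Fin 4) ℂ)).compr₂ (Matrix.traceLinearMap (Fin 4) ℂ ℂ)
    have hψ : ∀ Z X, ψ Z X = (Z * X).trace := fun Z X => rfl
    have hψinj : Function.Injective ψ := by
      intro Z Z' hZ
      refine Matrix.ext_iff_trace_mul_right.mpr fun X => ?_
      rw [← hψ, ← hψ, hZ]
    obtain ⟨Z, rfl⟩ := (LinearMap.injective_iff_surjective_of_finrank_eq_finrank
      (Subspace.dual_finrank_eq).symm).mp hψinj φ
    have hZ : Z ≠ 0 := by rintro rfl; simp at hφ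
    simp only [hψ] at h
    have key : ∀ T : Matrix (Fin 4) (Fin 4) ℂ, (∀ X, (Z * (Tᴴ * X * T)).trace = (Z * X).trace) →
        T * Z * Tᴴ = Z := by
      intro T hZT
      refine Matrix.ext_iff_trace_mul_right.mpr fun X => ?_
      rw [← hZT X, ← Matrix.mul_assoc, Matrix.trace_mul_comm (Z * (Tᴴ * X)) T]
      simp only [Matrix.mul_assoc]
    have k0 := key T₀ fun X => (h X).2.2
    have k1 := key T₁ fun X => (h X).2.1
    have k2 := key Tinf fun X => (h X).1
    have mem : ∀ T : Matrix (Fin 4) (Fin 4) ℂ, T.det ≠ 0 → T * Z * Tᴴ = Z →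
        ∀ v ∈ LinearMap.range Z.mulVecLin, T *ᵥ v ∈ LinearMap.range Z.mulVecLin := by
      rintro T hT hTZ _ ⟨v, rfl⟩
      have hT' : IsUnit Tᴴ := by
        rw [Matrix.isUnit_iff_isUnit_det, Matrix.det_conjTranspose]
        simpa using hT
      obtain ⟨w, rfl⟩ := Matrix.mulVec_surjective_iff_isUnit.mpr hT' v
      refine ⟨w, ?_⟩
      rw [Matrix.mulVecLin_apply, Matrix.mulVecLin_apply, Matrix.mulVec_mulVec,
        Matrix.mulVec_mulVec, hTZ]
    rcases hirr (LinearMap.range Z.mulVecLin)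
      (fun v hv => ⟨mem _ n0 k0 v hv, mem _ n1 k1 v hv, mem _ n2 k2 v hv⟩) with hr | hr
    · rw [LinearMap.range_eq_bot] at hr
      refine absurd ?_ hZ
      ext i j
      have := congrFun (congrArg (fun f : (Fin 4 → ℂ) →ₗ[ℂ] (Fin 4 → ℂ) => f (Pi.single j 1)) hr) i
      simpa using this
    · have hu : IsUnit Z := by
        rw [← Matrix.mulVec_surjective_iff_isUnit]
        exact LinearMap.range_eq_top.mp hr
      have hud := (Matrix.isUnit_iff_isUnit_det Z).mp hu
      have inv : ∀ T : Matrix (Fin 4) (Fin 4) ℂ, T * Z * Tᴴ = Z → Tᴴ * Z⁻¹ * T = Z⁻¹ := by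
        intro T hTZ
        have e1 : T * (Z * Tᴴ * Z⁻¹) = 1 := by
          rw [← Matrix.mul_assoc, ← Matrix.mul_assoc, hTZ, Matrix.mul_nonsing_inv _ hud]
        have e2 : Z * (Tᴴ * Z⁻¹ * T) = 1 := by
          rw [mul_eq_one_comm] at e1
          simpa only [Matrix.mul_assoc] using e1
        exact (Matrix.inv_eq_right_inv e2).symm
      refine ⟨Z⁻¹, fun h0 => ?_, inv _ k0, inv _ k1, inv _ k2⟩
      have := Matrix.mul_nonsing_inv _ hud
      rw [h0, Matrix.mul_zero] at this
      exact zero_ne_one this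

/-- For an invariant form `K`, either `K + Kᴴ` is nonzero or `i K` is Hermitian. -/
theorem IsGII.exists_hermitian {a₁ a₂ b : Circle} {c : Fin 4 → Circle}
    (hT : IsGII a₁ a₂ b c T₀ T₁ Tinf) (hirr : IsIrreducibleTriple T₀ T₁ Tinf) :
    ∃ H : Matrix (Fin 4) (Fin 4) ℂ, H ≠ 0 ∧ IsInvariantHermitian T₀ T₁ Tinf H := by
  obtain ⟨K, hK, h0, h1, h2⟩ := hT.exists_form hirr
  have adj : ∀ T : Matrix (Fin 4) (Fin 4) ℂ, Tᴴ * K * T = K → Tᴴ * Kᴴ * T = Kᴴ := by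
    intro T h
    have := congrArg Matrix.conjTranspose h
    simpa [Matrix.mul_assoc] using this
  by_cases hs : K + Kᴴ = 0
  · refine ⟨Complex.I • K, by simpa using hK, ?_, ?_, ?_, ?_⟩
    · rw [Matrix.IsHermitian, Matrix.conjTranspose_smul, ← neg_eq_of_add_eq_zero_right hs]
      simp
    all_goals rw [Matrix.mul_smul, Matrix.smul_mul]; simp only [h0, h1, h2]
  · refine ⟨K + Kᴴ, hs, ?_, ?_, ?_, ?_⟩
    · rw [Matrix.IsHermitian, Matrix.conjTranspose_add, Matrix.conjTranspose_conjTranspose,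
        add_comm]
    all_goals rw [Matrix.mul_add, Matrix.add_mul]
    · rw [h0, adj _ h0]
    · rw [h1, adj _ h1]
    · rw [h2, adj _ h2]

/-- If `μ` is an eigenvalue of `H⁻¹ H'`, then `H' - μ H` is a degenerate invariant form, hence
zero. -/
theorem IsIrreducibleTriple.hermitian_unique (hirr : IsIrreducibleTriple T₀ T₁ Tinf)
    (hprod : T₀ * T₁ * Tinf = 1) {H H' : Matrix (Fin 4) (Fin 4) ℂ} (hH0 : H ≠ 0)
    (hH : IsInvariantHermitian T₀ T₁ Tinf H) (hH' : IsInvariantHermitian T₀ T₁ Tinf H') :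
    ∃ r : ℝ, H' = (r : ℂ) • H := by
  have hdet : IsUnit H.det := by
    rw [isUnit_iff_ne_zero]
    intro h
    obtain ⟨x, hx, hHx⟩ := Matrix.exists_mulVec_eq_zero_iff.mpr h
    exact hH0 (hirr.form_eq_zero_of_mulVec_eq_zero hprod hH.inv_zero hH.inv_one hH.inv_inf hx hHx)
  obtain ⟨μ, hμ⟩ := Module.End.exists_eigenvalue (H⁻¹ * H').mulVecLin
  obtain ⟨x, hx⟩ := hμ.exists_hasEigenvector
  have hx1 : (H⁻¹ * H') *ᵥ x = μ • x := hx.apply_eq_smul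
  have hKx : (H' - μ • H) *ᵥ x = 0 := by
    have := congrArg (H *ᵥ ·) hx1
    simp only [Matrix.mulVec_mulVec, Matrix.mulVec_smul] at this
    rw [← Matrix.mul_assoc, Matrix.mul_nonsing_inv _ hdet, Matrix.one_mul] at this
    rw [Matrix.sub_mulVec, Matrix.smul_mulVec, this, sub_self]
  have inv : ∀ T : Matrix (Fin 4) (Fin 4) ℂ, Tᴴ * H * T = H → Tᴴ * H' * T = H' →
      Tᴴ * (H' - μ • H) * T = H' - μ • H := by
    intro T h h'
    rw [Matrix.mul_sub, Matrix.sub_mul, Matrix.mul_smul, Matrix.smul_mul, h, h']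
  have hK := hirr.form_eq_zero_of_mulVec_eq_zero hprod (inv _ hH.inv_zero hH'.inv_zero)
    (inv _ hH.inv_one hH'.inv_one) (inv _ hH.inv_inf hH'.inv_inf) hx.2 hKx
  rw [sub_eq_zero] at hK
  have hreal : star μ = μ := by
    have h1 : star μ • H = μ • H := by
      rw [← hK, ← hH'.isHermitian.eq, hK, Matrix.conjTranspose_smul, hH.isHermitian.eq]
    have h2 : (star μ - μ) • H = 0 := by rw [sub_smul, h1, sub_self]
    rcases smul_eq_zero.mp h2 with h | h
    · exact sub_eq_zero.mp h
    · exact absurd h hH0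
  exact ⟨μ.re, by rw [hK, Complex.conj_eq_iff_re.mp hreal]⟩

end InvariantForms

/-! ### Arcs of the unit circle -/

/-- Twice the signed area of the triangle `p`, `z`, `q`: positive if `z` lies on the right of the
line from `p` to `q`, which on the circle is the counterclockwise arc from `p` to `q`. -/
def orient (p z q : Circle) : ℝ := ((starRingEnd ℂ ((z : ℂ) - p)) * ((q : ℂ) - p)).im

theorem orient_swap (p z q : Circle) : orient q z p = -orient p z q := by
  simp only [orient, Complex.mul_im, Complex.conj_re, Complex.conj_im, Complex.sub_re,
    Complex.sub_im]
  ring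

theorem orient_mul_exp (p : Circle) (s t : ℝ) :
    orient p (p * Circle.exp s) (p * Circle.exp t) =
      4 * (Real.sin (s / 2) * Real.sin (t / 2) * Real.sin ((t - s) / 2)) := by
  have hp : (p : ℂ).re * (p : ℂ).re + (p : ℂ).im * (p : ℂ).im = 1 := by
    rw [← Complex.normSq_apply, Circle.normSq_coe]
  have e : orient p (p * Circle.exp s) (p * Circle.exp t) =
      (Real.cos s - 1) * Real.sin t - Real.sin s * (Real.cos t - 1) := by
    simp only [orient, Circle.coe_mul, Circle.coe_exp, Complex.mul_im, Complex.mul_re,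
      Complex.conj_re, Complex.conj_im, Complex.sub_re, Complex.sub_im,
      Complex.exp_ofReal_mul_I_re, Complex.exp_ofReal_mul_I_im]
    linear_combination ((Real.cos s - 1) * Real.sin t - Real.sin s * (Real.cos t - 1)) * hp
  have hs : s = 2 * (s / 2) := by ring
  have ht : t = 2 * (t / 2) := by ring
  have hst : (t - s) / 2 = t / 2 - s / 2 := by ring
  rw [e, hst, Real.sin_sub, hs, ht, Real.cos_two_mul, Real.cos_two_mul, Real.sin_two_mul,
    Real.sin_two_mul]
  have h1 := Real.sin_sq_add_cos_sq (s / 2)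
  have h2 := Real.sin_sq_add_cos_sq (t / 2)
  simp only [← hs, ← ht]
  linear_combination (4 * Real.sin (t / 2) * Real.cos (t / 2)) * h1 -
    4 * Real.sin (s / 2) * Real.cos (s / 2) * h2

theorem exists_exp_of_circle (z : Circle) :
    ∃ s : ℝ, 0 ≤ s ∧ s < 2 * Real.pi ∧ z = Circle.exp s := by
  have hpi := Real.pi_pos
  rcases lt_or_ge (Complex.arg z) 0 with h | h
  · refine ⟨Complex.arg z + 2 * Real.pi, ?_, by linarith, ?_⟩
    · linarith [Complex.neg_pi_lt_arg (z : ℂ)]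
    · rw [Circle.exp_add_two_pi, Circle.exp_arg]
  · exact ⟨Complex.arg z, h, by linarith [Complex.arg_le_pi (z : ℂ)], (Circle.exp_arg z).symm⟩

theorem mem_ccwArc_iff {p q z : Circle} : z ∈ ccwArc p q ↔ 0 < orient p z q := by
  have hpi := Real.pi_pos
  constructor
  · rintro ⟨s, t, hs, hst, ht, rfl, rfl⟩
    rw [orient_mul_exp]
    have h1 : 0 < Real.sin (s / 2) := Real.sin_pos_of_pos_of_lt_pi (by linarith) (by linarith)
    have h2 : 0 < Real.sin (t / 2) := Real.sin_pos_of_pos_of_lt_pi (by linarith) (by linarith)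
    have h3 : 0 < Real.sin ((t - s) / 2) :=
      Real.sin_pos_of_pos_of_lt_pi (by linarith) (by linarith)
    positivity
  · intro h
    obtain ⟨s, hs0, hs, hsz⟩ := exists_exp_of_circle (p⁻¹ * z)
    obtain ⟨t, ht0, ht, htq⟩ := exists_exp_of_circle (p⁻¹ * q)
    obtain rfl : z = p * Circle.exp s := by rw [← hsz, mul_inv_cancel_left]
    obtain rfl : q = p * Circle.exp t := by rw [← htq, mul_inv_cancel_left]
    rw [orient_mul_exp] at h
    have h1 : 0 ≤ Real.sin (s / 2) := Real.sin_nonneg_of_nonneg_of_le_pi (by linarith) (by linarith)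
    have h2 : 0 ≤ Real.sin (t / 2) := Real.sin_nonneg_of_nonneg_of_le_pi (by linarith) (by linarith)
    refine ⟨s, t, ?_, ?_, ht, rfl, rfl⟩
    · rcases hs0.eq_or_lt with rfl | hs0
      · simp at h
      · exact hs0
    · by_contra hle
      have h3 : Real.sin ((t - s) / 2) ≤ 0 :=
        Real.sin_nonpos_of_nonpos_of_neg_pi_le (by linarith) (by linarith)
      have := mul_nonpos_of_nonneg_of_nonpos (mul_nonneg h1 h2) h3
      linarith

/-- An open arc is cut out of the circle by the sign of `orient`. -/
theorem IsOpenArc.exists_sign {p q : Circle} {I : Set Circle} (hI : IsOpenArc p q I) :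
    ∃ ε : ℝ, (ε = 1 ∨ ε = -1) ∧ ∀ z, z ∈ I ↔ 0 < ε * orient p z q := by
  rcases hI with rfl | rfl
  · exact ⟨1, Or.inl rfl, fun z => by rw [mem_ccwArc_iff, one_mul]⟩
  · exact ⟨-1, Or.inr rfl, fun z => by rw [mem_ccwArc_iff, orient_swap, neg_one_mul]⟩

theorem Circle.conj_coe (z : Circle) : starRingEnd ℂ (z : ℂ) = (z : ℂ)⁻¹ := by
  rw [← Circle.coe_inv_eq_conj, Circle.coe_inv]

/-- A coordinate on the circle without `1` that vanishes at `b⁻¹`. For `c = exp (i γ)`,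
`b = exp (i β)` it is `(cot (β / 2) + cot (γ / 2)) / 2`, because `1 / (1 - z)` has real part `1 / 2`
on the circle. -/
noncomputable def cotCoord (b c : Circle) : ℝ :=
  ((1 - (b : ℂ))⁻¹).im - ((1 - (c : ℂ)⁻¹)⁻¹).im

theorem inv_one_sub_circle {z : Circle} (hz : (z : ℂ) ≠ 1) :
    (1 - (z : ℂ))⁻¹ = 1 / 2 + ((1 - (z : ℂ))⁻¹).im * Complex.I := by
  have h0 : (z : ℂ) ≠ 0 := z.coe_ne_zero
  have h1 : 1 - (z : ℂ) ≠ 0 := sub_ne_zero.mpr hz.symm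
  have h2 : (z : ℂ) - 1 ≠ 0 := sub_ne_zero.mpr hz
  have hc : starRingEnd ℂ (1 - (z : ℂ))⁻¹ = 1 - (1 - (z : ℂ))⁻¹ := by
    rw [map_inv₀, map_sub, map_one, Circle.conj_coe]
    have : 1 - (z : ℂ)⁻¹ ≠ 0 := by
      rw [show 1 - (z : ℂ)⁻¹ = (z - 1) / z by field_simp]
      exact div_ne_zero h2 h0
    field_simp
    ring
  have hre : ((1 - (z : ℂ))⁻¹).re = 1 / 2 := by
    have := congrArg Complex.re hc
    rw [Complex.conj_re, Complex.sub_re, Complex.one_re] at this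
    linarith
  apply Complex.ext
  · simp [hre]
  · simp

theorem cotCoord_mul_I {b c : Circle} (hb : (b : ℂ) ≠ 1) (hc : (c : ℂ)⁻¹ ≠ 1) :
    (cotCoord b c : ℂ) * Complex.I = (1 - (b : ℂ))⁻¹ - (1 - (c : ℂ)⁻¹)⁻¹ := by
  have h1 := inv_one_sub_circle hb
  have h2 := inv_one_sub_circle (z := c⁻¹) (by rwa [Circle.coe_inv])
  rw [Circle.coe_inv] at h2
  rw [h1, h2, cotCoord]
  push_cast
  simp
  ring

/-- The sign of `cotCoord b` decides on which arc between `1` and `b⁻¹` a point lies. -/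
theorem orient_one_eq_mul_cotCoord {b c : Circle} (hb : (b : ℂ) ≠ 1) (hc : (c : ℂ)⁻¹ ≠ 1) :
    ∃ r : ℝ, 0 < r ∧ orient 1 c b⁻¹ = r * cotCoord b c := by
  have hb1 : 1 - (b : ℂ) ≠ 0 := sub_ne_zero.mpr hb.symm
  have hc1 : 1 - (c : ℂ)⁻¹ ≠ 0 := sub_ne_zero.mpr hc.symm
  have hb2 : (b : ℂ) - 1 ≠ 0 := sub_ne_zero.mpr hb
  have hb0 : (b : ℂ) ≠ 0 := b.coe_ne_zero
  have hc0 : (c : ℂ) ≠ 0 := c.coe_ne_zero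
  have hc2 : (c : ℂ) - 1 ≠ 0 := by
    intro h
    rw [sub_eq_zero.mp h] at hc1
    simp at hc1
  refine ⟨Complex.normSq (1 - (b : ℂ)) * Complex.normSq (1 - (c : ℂ)⁻¹) / 2, ?_, ?_⟩
  · have := Complex.normSq_pos.mpr hb1
    have := Complex.normSq_pos.mpr hc1
    positivity
  · have key := cotCoord_mul_I hb hc
    have hz : ((orient 1 c b⁻¹ : ℝ) : ℂ) = ((Complex.normSq (1 - (b : ℂ)) *
        Complex.normSq (1 - (c : ℂ)⁻¹) / 2 * cotCoord b c : ℝ) : ℂ) := by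
      apply mul_right_cancel₀ Complex.I_ne_zero
      push_cast
      rw [mul_assoc _ (cotCoord b c : ℂ), key, ← Complex.mul_conj, ← Complex.mul_conj, orient,
        Complex.im_eq_sub_conj]
      simp only [map_mul, map_sub, map_one, Circle.conj_coe, Circle.coe_inv, Circle.coe_one,
        map_inv₀, inv_inv]
      field_simp
      ring
    exact_mod_cast hz

theorem orient_eq (p z q : Circle) :
    (orient p z q : ℂ) =
      ((p : ℂ)⁻¹ - (q : ℂ)⁻¹) / (2 * Complex.I) * (p * q * (z : ℂ)⁻¹ + z - p - q) := by
  have hp : (p : ℂ) ≠ 0 := p.coe_ne_zero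
  have hq : (q : ℂ) ≠ 0 := q.coe_ne_zero
  have hz : (z : ℂ) ≠ 0 := z.coe_ne_zero
  rw [orient, Complex.im_eq_sub_conj]
  simp only [map_mul, map_sub, Circle.conj_coe, map_inv₀, inv_inv]
  field_simp
  ring

/-! ### Minors and the cubic resolvent -/

section Minors

variable {K : Type*} [Field K]

/-- If the weighted row sums of the minors vanish, then opposite weighted minors agree. -/
theorem opposite_minors_eq [CharZero K] {u₀ u₁ u₂ u₃ e₀₁ e₀₂ e₀₃ e₁₂ e₁₃ e₂₃ : K}
    (h0 : e₀₁ * u₁ + e₀₂ * u₂ + e₀₃ * u₃ = 0) (h1 : e₀₁ * u₀ + e₁₂ * u₂ + e₁₃ * u₃ = 0)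
    (h2 : e₀₂ * u₀ + e₁₂ * u₁ + e₂₃ * u₃ = 0) (h3 : e₀₃ * u₀ + e₁₃ * u₁ + e₂₃ * u₂ = 0) :
    e₂₃ * u₂ * u₃ = e₀₁ * u₀ * u₁ ∧ e₁₃ * u₁ * u₃ = e₀₂ * u₀ * u₂ ∧
      e₁₂ * u₁ * u₂ = e₀₃ * u₀ * u₃ ∧ e₀₁ * u₀ * u₁ + e₀₂ * u₀ * u₂ + e₀₃ * u₀ * u₃ = 0 := by
  have two : (2 : K) ≠ 0 := two_ne_zero
  refine ⟨?_, ?_, ?_, ?_⟩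
  · apply mul_left_cancel₀ two
    linear_combination u₂ * h2 + u₃ * h3 - u₀ * h0 - u₁ * h1
  · apply mul_left_cancel₀ two
    linear_combination u₁ * h1 + u₃ * h3 - u₀ * h0 - u₂ * h2
  · apply mul_left_cancel₀ two
    linear_combination u₁ * h1 + u₂ * h2 - u₀ * h0 - u₃ * h3
  · linear_combination u₀ * h0

/-- Weighted sums of the minors `eᵢⱼ = f (yᵢ yⱼ) / (xᵢ xⱼ)`, with denominators cleared. -/
theorem prod_mul_sum_minors {x₀ x₁ x₂ x₃ y₀ y₁ y₂ y₃ e₀₁ e₀₂ e₀₃ e₁₂ e₁₃ e₂₃ f₁ f₂ f₃ : K}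
    (h01 : e₀₁ * (x₀ * x₁) = f₁ * (y₀ * y₁)) (h23 : e₂₃ * (x₂ * x₃) = f₁ * (y₂ * y₃))
    (h02 : e₀₂ * (x₀ * x₂) = f₂ * (y₀ * y₂)) (h13 : e₁₃ * (x₁ * x₃) = f₂ * (y₁ * y₃))
    (h03 : e₀₃ * (x₀ * x₃) = f₃ * (y₀ * y₃)) (h12 : e₁₂ * (x₁ * x₂) = f₃ * (y₁ * y₂))
    (w₀₁ w₀₂ w₀₃ w₁₂ w₁₃ w₂₃ : K) :
    x₀ * x₁ * x₂ * x₃ * (e₀₁ * w₀₁ + e₀₂ * w₀₂ + e₀₃ * w₀₃ + e₁₂ * w₁₂ + e₁₃ * w₁₃ + e₂₃ * w₂₃) =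
      f₁ * (w₀₁ * (y₀ * y₁ * x₂ * x₃) + w₂₃ * (y₂ * y₃ * x₀ * x₁)) +
      f₂ * (w₀₂ * (y₀ * y₂ * x₁ * x₃) + w₁₃ * (y₁ * y₃ * x₀ * x₂)) +
      f₃ * (w₀₃ * (y₀ * y₃ * x₁ * x₂) + w₁₂ * (y₁ * y₂ * x₀ * x₃)) := by
  linear_combination w₀₁ * x₂ * x₃ * h01 + w₂₃ * x₀ * x₁ * h23 + w₀₂ * x₁ * x₃ * h02 +
    w₁₃ * x₀ * x₂ * h13 + w₀₃ * x₁ * x₂ * h03 + w₁₂ * x₀ * x₃ * h12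

/-- The weighted minors `f₁ = f₀₁ = f₂₃`, `f₂ = f₀₂ = f₁₃`, `f₃ = f₀₃ = f₁₂` solve a Vandermonde
system in the roots `d₀ d₁ + d₂ d₃`, `d₀ d₂ + d₁ d₃`, `d₀ d₃ + d₁ d₂` of the cubic resolvent.The
last identity is a weighted sum of the minors that, on the circle, has positive weights up to a
common factor; it detects the sign of the solution. -/
theorem resolvent_moments {d₀ d₁ d₂ d₃ b a₁ a₂ e₀₁ e₀₂ e₀₃ e₁₂ e₁₃ e₂₃ f₁ f₂ f₃ : K}
    (h01 : e₀₁ * ((b - d₀) * (b - d₁)) = f₁ * ((1 - d₀) * (1 - d₁)))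
    (h23 : e₂₃ * ((b - d₂) * (b - d₃)) = f₁ * ((1 - d₂) * (1 - d₃)))
    (h02 : e₀₂ * ((b - d₀) * (b - d₂)) = f₂ * ((1 - d₀) * (1 - d₂)))
    (h13 : e₁₃ * ((b - d₁) * (b - d₃)) = f₂ * ((1 - d₁) * (1 - d₃)))
    (h03 : e₀₃ * ((b - d₀) * (b - d₃)) = f₃ * ((1 - d₀) * (1 - d₃)))
    (h12 : e₁₂ * ((b - d₁) * (b - d₂)) = f₃ * ((1 - d₁) * (1 - d₂)))
    (hf : f₁ + f₂ + f₃ = 0) (hs : e₀₁ + e₀₂ + e₀₃ + e₁₂ + e₁₃ + e₂₃ = 1)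
    (ht : (1 - b) * (e₀₁ * (d₀ + d₁) + e₀₂ * (d₀ + d₂) + e₀₃ * (d₀ + d₃) + e₁₂ * (d₁ + d₂) +
      e₁₃ * (d₁ + d₃) + e₂₃ * (d₂ + d₃)) = b * (2 + a₁ + a₂ - (d₀ + d₁ + d₂ + d₃)))
    (hd : d₀ * d₁ * d₂ * d₃ = b ^ 2 * (a₁ * a₂))
    (hbd : (b - d₀) * (b - d₁) * (b - d₂) * (b - d₃) ≠ 0) :
    (1 - b) ^ 2 * f₁ * (((d₀ - d₃) * (d₁ - d₂)) * ((d₀ - d₂) * (d₁ - d₃))) =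
        (b - d₀) * (b - d₁) * (b - d₂) * (b - d₃) * (d₀ * d₁ + d₂ * d₃ - b * (a₁ + a₂)) ∧
      (1 - b) ^ 2 * f₂ * (-((d₀ - d₃) * (d₁ - d₂)) * ((d₀ - d₁) * (d₂ - d₃))) =
        (b - d₀) * (b - d₁) * (b - d₂) * (b - d₃) * (d₀ * d₂ + d₁ * d₃ - b * (a₁ + a₂)) ∧
      (1 - b) ^ 2 * f₃ * (((d₀ - d₂) * (d₁ - d₃)) * ((d₀ - d₁) * (d₂ - d₃))) =
        (b - d₀) * (b - d₁) * (b - d₂) * (b - d₃) * (d₀ * d₃ + d₁ * d₂ - b * (a₁ + a₂)) ∧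
      (1 - b) ^ 2 * (e₀₁ * (d₀ * d₁) * ((1 - d₂) * (1 - d₃)) ^ 2 +
          e₂₃ * (d₂ * d₃) * ((1 - d₀) * (1 - d₁)) ^ 2 +
          e₀₂ * (d₀ * d₂) * ((1 - d₁) * (1 - d₃)) ^ 2 +
          e₁₃ * (d₁ * d₃) * ((1 - d₀) * (1 - d₂)) ^ 2 +
          e₀₃ * (d₀ * d₃) * ((1 - d₁) * (1 - d₂)) ^ 2 +
          e₁₂ * (d₁ * d₂) * ((1 - d₀) * (1 - d₃)) ^ 2) =
        b ^ 2 * ((1 - a₁) * (1 - a₂)) * ((1 - d₀) * (1 - d₁) * (1 - d₂) * (1 - d₃)) := by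
  obtain rfl : f₃ = -f₁ - f₂ := by linear_combination hf
  have W := prod_mul_sum_minors h01 h23 h02 h13 h03 h12
  have m1 : (1 - b) ^ 2 * (f₁ * (d₀ * d₁ + d₂ * d₃) + f₂ * (d₀ * d₂ + d₁ * d₃) +
      (-f₁ - f₂) * (d₀ * d₃ + d₁ * d₂)) = (b - d₀) * (b - d₁) * (b - d₂) * (b - d₃) := by
    have h := W 1 1 1 1 1 1
    simp only [mul_one, one_mul] at h
    rw [hs, mul_one] at h
    rw [h]
    ring
  have m2 : (1 - b) ^ 2 * (f₁ * (d₀ * d₁ + d₂ * d₃) ^ 2 + f₂ * (d₀ * d₂ + d₁ * d₃) ^ 2 +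
      (-f₁ - f₂) * (d₀ * d₃ + d₁ * d₂) ^ 2) = (b - d₀) * (b - d₁) * (b - d₂) * (b - d₃) *
      (d₀ * d₁ + d₀ * d₂ + d₀ * d₃ + d₁ * d₂ + d₁ * d₃ + d₂ * d₃ - b * (a₁ + a₂)) := by
    have h := congrArg (fun x => (b - d₀) * (b - d₁) * (b - d₂) * (b - d₃) * x) ht
    simp only [mul_left_comm _ (1 - b) _] at h
    rw [W] at h
    rw [← m1] at h ⊢
    linear_combination -h
  refine ⟨?_, ?_, ?_, ?_⟩
  · rw [← m1] at m2 ⊢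
    linear_combination m2
  · rw [← m1] at m2 ⊢
    linear_combination m2
  · rw [← m1] at m2 ⊢
    linear_combination m2
  · apply mul_left_cancel₀ hbd
    have hE1 : (1 - b) ^ 2 * (f₁ * (d₀ * d₁ * ((1 - d₂) * (1 - d₃) * (b - d₂) * (b - d₃)) +
          d₂ * d₃ * ((1 - d₀) * (1 - d₁) * (b - d₀) * (b - d₁))) +
        f₂ * (d₀ * d₂ * ((1 - d₁) * (1 - d₃) * (b - d₁) * (b - d₃)) +
          d₁ * d₃ * ((1 - d₀) * (1 - d₂) * (b - d₀) * (b - d₂))) +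
        (-f₁ - f₂) * (d₀ * d₃ * ((1 - d₁) * (1 - d₂) * (b - d₁) * (b - d₂)) +
          d₁ * d₂ * ((1 - d₀) * (1 - d₃) * (b - d₀) * (b - d₃)))) =
        (b - d₀) * (b - d₁) * (b - d₂) * (b - d₃) * (b ^ 2 * ((1 - a₁) * (1 - a₂))) := by
      have hR : b ^ 2 * ((1 - a₁) * (1 - a₂)) =
          b ^ 2 - b * (b * (a₁ + a₂)) + d₀ * d₁ * d₂ * d₃ := by rw [hd]; ring
      rw [hR]
      rw [← m1] at m2 ⊢
      linear_combination b * m2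
    have h := W (d₀ * d₁ * ((1 - d₂) * (1 - d₃)) ^ 2) (d₀ * d₂ * ((1 - d₁) * (1 - d₃)) ^ 2)
      (d₀ * d₃ * ((1 - d₁) * (1 - d₂)) ^ 2) (d₁ * d₂ * ((1 - d₀) * (1 - d₃)) ^ 2)
      (d₁ * d₃ * ((1 - d₀) * (1 - d₂)) ^ 2) (d₂ * d₃ * ((1 - d₀) * (1 - d₁)) ^ 2)
    generalize (b - d₀) * (b - d₁) * (b - d₂) * (b - d₃) = X at *
    generalize b - d₀ = x₀ at *
    generalize b - d₁ = x₁ at *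
    generalize b - d₂ = x₂ at *
    generalize b - d₃ = x₃ at *
    generalize 1 - d₀ = y₀ at *
    generalize 1 - d₁ = y₁ at *
    generalize 1 - d₂ = y₂ at *
    generalize 1 - d₃ = y₃ at *
    generalize (1 - b) ^ 2 = s at *
    linear_combination s * h + (y₀ * y₁ * y₂ * y₃) * hE1

end Minors

/-! ### The minors in real coordinates -/

theorem Circle.one_sub_sq (z : Circle) :
    (1 - (z : ℂ)) ^ 2 = -(z : ℂ) * Complex.normSq (1 - (z : ℂ)) := by
  have h0 : (z : ℂ) ≠ 0 := z.coe_ne_zero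
  rw [← Complex.mul_conj, map_sub, map_one, Circle.conj_coe]
  field_simp
  ring

/-- As a function of `z = (d₀ d₁)⁻¹`, `orient` is a root of the cubic resolvent of the `dᵢ`, shifted
by `b (a₁ + a₂)`, up to a constant. -/
theorem orient_mul_eq {a₁ a₂ b : Circle} {d₀ d₁ d₂ d₃ : ℂ} {z : Circle} (h0 : d₀ ≠ 0) (h1 : d₁ ≠ 0)
    (hd : d₀ * d₁ * d₂ * d₃ = (b : ℂ) ^ 2 * (a₁ * a₂)) (hz : (z : ℂ) = d₀⁻¹ * d₁⁻¹) :
    (orient (b⁻¹ * a₁⁻¹) z (b⁻¹ * a₂⁻¹) : ℂ) =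
      (a₁ - a₂) / (2 * Complex.I * (b * a₁ * a₂)) * (d₀ * d₁ + d₂ * d₃ - b * (a₁ + a₂)) := by
  have hb : (b : ℂ) ≠ 0 := b.coe_ne_zero
  have ha1 : (a₁ : ℂ) ≠ 0 := a₁.coe_ne_zero
  have ha2 : (a₂ : ℂ) ≠ 0 := a₂.coe_ne_zero
  have hI := Complex.I_ne_zero
  have hz' : (z : ℂ) = d₂ * d₃ * ((b : ℂ)⁻¹ * (a₁ : ℂ)⁻¹ * ((b : ℂ)⁻¹ * (a₂ : ℂ)⁻¹)) := by
    rw [hz]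
    field_simp
    linear_combination -hd
  have hzi : (z : ℂ)⁻¹ = d₀ * d₁ := by
    rw [hz, mul_inv, inv_inv, inv_inv]
  rw [orient_eq, hzi, hz']
  simp only [Circle.coe_mul, Circle.coe_inv]
  field_simp
  ring

/-- The real form of `resolvent_moments`. In the coordinates `v = cotCoord b (c i)` and with
`θ = orient` evaluated at the products of two eigenvalues, the weighted minors are rational functions of the
`v i` and of `θ`; `κ` is the ratio between the differences of the values of `θ` and those of the
roots `v₀ v₁ + v₂ v₃`, `v₀ v₂ + v₁ v₃`, `v₀ v₃ + v₁ v₂` of the cubic resolvent of the `v i`. -/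
theorem real_moments {a₁ a₂ b : Circle} {c : Fin 4 → Circle} (hb : (b : ℂ) ≠ 1)
    (ha : a₁ ≠ a₂)
    (hc1 : ∀ i, (c i : ℂ)⁻¹ ≠ 1) (hcb : ∀ i, (c i : ℂ)⁻¹ ≠ b) (hinj : Function.Injective c)
    (hd : (c 0 : ℂ)⁻¹ * (c 1 : ℂ)⁻¹ * (c 2 : ℂ)⁻¹ * (c 3 : ℂ)⁻¹ = (b : ℂ) ^ 2 * (a₁ * a₂))
    {v : Fin 4 → ℝ} (hv : ∀ i, v i = cotCoord b (c i))
    {θ : Circle → ℝ} (hθ : ∀ z, θ z = orient (b⁻¹ * a₁⁻¹) z (b⁻¹ * a₂⁻¹))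
    {e₀₁ e₀₂ e₀₃ e₁₂ e₁₃ e₂₃ : ℝ}
    (h0 : e₀₁ * v 1 + e₀₂ * v 2 + e₀₃ * v 3 = 0) (h1 : e₀₁ * v 0 + e₁₂ * v 2 + e₁₃ * v 3 = 0)
    (h2 : e₀₂ * v 0 + e₁₂ * v 1 + e₂₃ * v 3 = 0) (h3 : e₀₃ * v 0 + e₁₃ * v 1 + e₂₃ * v 2 = 0)
    (hs : e₀₁ + e₀₂ + e₀₃ + e₁₂ + e₁₃ + e₂₃ = 1)
    (ht : (1 - (b : ℂ)) * (e₀₁ * ((c 0 : ℂ)⁻¹ + (c 1 : ℂ)⁻¹) + e₀₂ * ((c 0 : ℂ)⁻¹ + (c 2 : ℂ)⁻¹) +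
      e₀₃ * ((c 0 : ℂ)⁻¹ + (c 3 : ℂ)⁻¹) + e₁₂ * ((c 1 : ℂ)⁻¹ + (c 2 : ℂ)⁻¹) +
      e₁₃ * ((c 1 : ℂ)⁻¹ + (c 3 : ℂ)⁻¹) + e₂₃ * ((c 2 : ℂ)⁻¹ + (c 3 : ℂ)⁻¹)) =
      b * (2 + a₁ + a₂ - ((c 0 : ℂ)⁻¹ + (c 1 : ℂ)⁻¹ + (c 2 : ℂ)⁻¹ + (c 3 : ℂ)⁻¹))) :
    (∀ i, v i ≠ 0) ∧ Function.Injective v ∧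
    θ (c 2 * c 3) = θ (c 0 * c 1) ∧ θ (c 1 * c 3) = θ (c 0 * c 2) ∧
    θ (c 1 * c 2) = θ (c 0 * c 3) ∧
    ∃ κ : ℝ, κ ≠ 0 ∧
      κ * (e₀₁ * v 0 * v 1) * ((v 0 - v 3) * (v 1 - v 2) * ((v 0 - v 2) * (v 1 - v 3))) =
        v 0 * v 1 * v 2 * v 3 * θ (c 0 * c 1) ∧
      κ * (e₀₂ * v 0 * v 2) * (-((v 0 - v 3) * (v 1 - v 2)) * ((v 0 - v 1) * (v 2 - v 3))) =
        v 0 * v 1 * v 2 * v 3 * θ (c 0 * c 2) ∧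
      κ * (e₀₃ * v 0 * v 3) * ((v 0 - v 2) * (v 1 - v 3) * ((v 0 - v 1) * (v 2 - v 3))) =
        v 0 * v 1 * v 2 * v 3 * θ (c 0 * c 3) ∧
      θ (c 0 * c 1) - θ (c 0 * c 2) = κ * ((v 0 - v 3) * (v 1 - v 2)) ∧
      θ (c 0 * c 1) - θ (c 0 * c 3) = κ * ((v 0 - v 2) * (v 1 - v 3)) ∧
      θ (c 0 * c 2) - θ (c 0 * c 3) = κ * ((v 0 - v 1) * (v 2 - v 3)) ∧
      ((0 < e₀₁ ∧ 0 < e₀₂ ∧ 0 < e₀₃ ∧ 0 < e₁₂ ∧ 0 < e₁₃ ∧ 0 < e₂₃) → 0 < κ * θ b⁻¹) := by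
  have hI := Complex.I_ne_zero
  have hb0 : (b : ℂ) ≠ 0 := b.coe_ne_zero
  have ha10 : (a₁ : ℂ) ≠ 0 := a₁.coe_ne_zero
  have ha20 : (a₂ : ℂ) ≠ 0 := a₂.coe_ne_zero
  have hb1 : 1 - (b : ℂ) ≠ 0 := sub_ne_zero.mpr hb.symm
  obtain ⟨d, hdc⟩ : ∃ d : Fin 4 → ℂ, ∀ i, (c i : ℂ)⁻¹ = d i := ⟨fun i => (c i : ℂ)⁻¹, fun _ => rfl⟩
  have hd0 : ∀ i, d i ≠ 0 := fun i => by rw [← hdc]; exact inv_ne_zero (c i).coe_ne_zero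
  have hcd : ∀ i, (c i : ℂ) = (d i)⁻¹ := fun i => by rw [← hdc, inv_inv]
  have hd1 : ∀ i, 1 - d i ≠ 0 := fun i => by rw [← hdc]; exact sub_ne_zero.mpr (hc1 i).symm
  have hdb : ∀ i, b - d i ≠ 0 := fun i => by rw [← hdc]; exact sub_ne_zero.mpr (hcb i).symm
  have hdinj : ∀ i j, i ≠ j → d i - d j ≠ 0 := fun i j hij h => hij (hinj (by
    rw [sub_eq_zero] at h
    exact Circle.ext (by rw [hcd, hcd, h])))
  have hV : ∀ i, (v i : ℂ) * Complex.I = (1 - (b : ℂ))⁻¹ - (1 - d i)⁻¹ := fun i => by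
    rw [hv, cotCoord_mul_I hb (hc1 i), hdc]
  have hbd : ∀ i, b - d i = v i * Complex.I * ((1 - b) * (1 - d i)) := fun i => by
    have := hd1 i
    rw [hV]
    field_simp
    ring
  have hvd : ∀ i j, d i - d j = -((v i - v j) * Complex.I * ((1 - d i) * (1 - d j))) := by
    intro i j
    have e1 := hd1 i
    have e2 := hd1 j
    rw [sub_mul (v i : ℂ), hV, hV]
    field_simp
    ring
  have hv0 : ∀ i, v i ≠ 0 := fun i h => hdb i (by rw [hbd, h]; simp)
  have hvinj : Function.Injective v := by
    intro i j hij
    by_contra hne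
    exact hdinj i j hne (by rw [hvd, hij]; simp)
  simp only [hdc] at hd ht
  set lam : ℂ := (a₁ - a₂) / (2 * Complex.I * (b * a₁ * a₂)) with hlam
  have hlam0 : lam ≠ 0 := by
    rw [hlam]
    have : (a₁ : ℂ) - a₂ ≠ 0 := sub_ne_zero.mpr fun h => ha (Circle.ext h)
    positivity
  have T01 : (θ (c 0 * c 1) : ℂ) = lam * (d 0 * d 1 + d 2 * d 3 - b * (a₁ + a₂)) := by
    rw [hθ, orient_mul_eq (hd0 0) (hd0 1) hd (by rw [Circle.coe_mul, hcd, hcd])]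
  have T23 : (θ (c 2 * c 3) : ℂ) = lam * (d 0 * d 1 + d 2 * d 3 - b * (a₁ + a₂)) := by
    rw [hθ, orient_mul_eq (d₂ := d 0) (d₃ := d 1) (hd0 2) (hd0 3) (by rw [← hd]; ring)
      (by rw [Circle.coe_mul, hcd, hcd]), add_comm (d 2 * d 3)]
  have T02 : (θ (c 0 * c 2) : ℂ) = lam * (d 0 * d 2 + d 1 * d 3 - b * (a₁ + a₂)) := by
    rw [hθ, orient_mul_eq (d₂ := d 1) (d₃ := d 3) (hd0 0) (hd0 2) (by rw [← hd]; ring)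
      (by rw [Circle.coe_mul, hcd, hcd])]
  have T13 : (θ (c 1 * c 3) : ℂ) = lam * (d 0 * d 2 + d 1 * d 3 - b * (a₁ + a₂)) := by
    rw [hθ, orient_mul_eq (d₂ := d 0) (d₃ := d 2) (hd0 1) (hd0 3) (by rw [← hd]; ring)
      (by rw [Circle.coe_mul, hcd, hcd]), add_comm (d 1 * d 3)]
  have T03 : (θ (c 0 * c 3) : ℂ) = lam * (d 0 * d 3 + d 1 * d 2 - b * (a₁ + a₂)) := by
    rw [hθ, orient_mul_eq (d₂ := d 1) (d₃ := d 2) (hd0 0) (hd0 3) (by rw [← hd]; ring)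
      (by rw [Circle.coe_mul, hcd, hcd])]
  have T12 : (θ (c 1 * c 2) : ℂ) = lam * (d 0 * d 3 + d 1 * d 2 - b * (a₁ + a₂)) := by
    rw [hθ, orient_mul_eq (d₂ := d 0) (d₃ := d 3) (hd0 1) (hd0 2) (by rw [← hd]; ring)
      (by rw [Circle.coe_mul, hcd, hcd]), add_comm (d 1 * d 2)]
  have Tb : (θ b⁻¹ : ℂ) = lam * (b * ((1 - a₁) * (1 - a₂))) := by
    rw [hθ, orient_mul_eq (a₁ := a₁) (a₂ := a₂) (d₀ := 1) (d₁ := b) (d₂ := a₁ * a₂) (d₃ := b)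
      one_ne_zero hb0 (by ring) (by rw [Circle.coe_inv]; simp)]
    ring
  obtain ⟨g1, g2, g3, gs⟩ := opposite_minors_eq h0 h1 h2 h3
  obtain ⟨M1, M2, M3, M4⟩ := resolvent_moments (K := ℂ) (d₀ := d 0) (d₁ := d 1) (d₂ := d 2)
    (d₃ := d 3) (b := b) (a₁ := a₁) (a₂ := a₂) (e₀₁ := e₀₁) (e₀₂ := e₀₂) (e₀₃ := e₀₃) (e₁₂ := e₁₂)
    (e₁₃ := e₁₃) (e₂₃ := e₂₃) (f₁ := -(1 - b) ^ 2 * (e₀₁ * v 0 * v 1 : ℝ))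
    (f₂ := -(1 - b) ^ 2 * (e₀₂ * v 0 * v 2 : ℝ)) (f₃ := -(1 - b) ^ 2 * (e₀₃ * v 0 * v 3 : ℝ))
    (by rw [hbd 0, hbd 1]; push_cast
        linear_combination (e₀₁ * v 0 * v 1 * (1 - b) ^ 2 * (1 - d 0) * (1 - d 1)) * Complex.I_sq)
    (by rw [hbd 2, hbd 3, ← g1]; push_cast
        linear_combination (e₂₃ * v 2 * v 3 * (1 - b) ^ 2 * (1 - d 2) * (1 - d 3)) * Complex.I_sq)
    (by rw [hbd 0, hbd 2]; push_cast
        linear_combination (e₀₂ * v 0 * v 2 * (1 - b) ^ 2 * (1 - d 0) * (1 - d 2)) * Complex.I_sq)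
    (by rw [hbd 1, hbd 3, ← g2]; push_cast
        linear_combination (e₁₃ * v 1 * v 3 * (1 - b) ^ 2 * (1 - d 1) * (1 - d 3)) * Complex.I_sq)
    (by rw [hbd 0, hbd 3]; push_cast
        linear_combination (e₀₃ * v 0 * v 3 * (1 - b) ^ 2 * (1 - d 0) * (1 - d 3)) * Complex.I_sq)
    (by rw [hbd 1, hbd 2, ← g3]; push_cast
        linear_combination (e₁₂ * v 1 * v 2 * (1 - b) ^ 2 * (1 - d 1) * (1 - d 2)) * Complex.I_sq)
    (by rw [← mul_add, ← mul_add, ← Complex.ofReal_add, ← Complex.ofReal_add, gs]; simp)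
    (by exact_mod_cast hs) ht hd
    (mul_ne_zero (mul_ne_zero (mul_ne_zero (hdb 0) (hdb 1)) (hdb 2)) (hdb 3))
  set Y : ℂ := (1 - d 0) * (1 - d 1) * (1 - d 2) * (1 - d 3) with hY
  have hY0 : Y ≠ 0 := mul_ne_zero (mul_ne_zero (mul_ne_zero (hd1 0) (hd1 1)) (hd1 2)) (hd1 3)
  have sub4 : ∀ i j k l : Fin 4, Y = (1 - d i) * (1 - d j) * ((1 - d k) * (1 - d l)) →
      (d i - d j) * (d k - d l) = -Y * ((v i - v j) * (v k - v l) : ℝ) := by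
    intro i j k l h
    rw [hvd i j, hvd k l, h]
    push_cast
    linear_combination ((v i - v j) * (v k - v l) * ((1 - d i) * (1 - d j)) *
      ((1 - d k) * (1 - d l))) * Complex.I_sq
  have s1 := sub4 0 3 1 2 (by rw [hY]; ring)
  have s2 := sub4 0 2 1 3 (by rw [hY]; ring)
  have s3 := sub4 0 1 2 3 (by rw [hY]; ring)
  have vsub : ∀ i j, i ≠ j → v i - v j ≠ 0 := fun i j h h' => h (hvinj (sub_eq_zero.mp h'))
  have hw : (v 0 - v 3) * (v 1 - v 2) ≠ 0 :=
    mul_ne_zero (vsub _ _ (by decide)) (vsub _ _ (by decide))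
  -- `κ` is real because it is a quotient of two real numbers.
  obtain ⟨κ, hκ⟩ : ∃ κ : ℝ, (κ : ℂ) = -lam * Y := by
    refine ⟨(θ (c 0 * c 1) - θ (c 0 * c 2)) / ((v 0 - v 3) * (v 1 - v 2)), ?_⟩
    have hw' : (((v 0 - v 3) * (v 1 - v 2) : ℝ) : ℂ) ≠ 0 := by exact_mod_cast hw
    rw [Complex.ofReal_div, div_eq_iff hw', Complex.ofReal_sub, T01, T02]
    linear_combination lam * s1
  have hκ0 : κ ≠ 0 := by
    intro h
    rw [h] at hκ
    exact mul_ne_zero (neg_ne_zero.mpr hlam0) hY0 (by rw [← hκ]; simp)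
  have hprod : (b - d 0) * (b - d 1) * (b - d 2) * (b - d 3) =
      (1 - b) ^ 4 * Y * (v 0 * v 1 * v 2 * v 3 : ℝ) := by
    rw [hbd 0, hbd 1, hbd 2, hbd 3, hY]
    push_cast
    linear_combination ((1 - b) ^ 4 * ((1 - d 0) * (1 - d 1) * (1 - d 2) * (1 - d 3)) *
      (v 0 * v 1 * v 2 * v 3)) * Complex.I_pow_four
  have hb4 : (1 - (b : ℂ)) ^ 4 * Y ≠ 0 := mul_ne_zero (pow_ne_zero _ hb1) hY0
  refine ⟨hv0, hvinj, by exact_mod_cast T23.trans T01.symm, by exact_mod_cast T13.trans T02.symm,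
    by exact_mod_cast T12.trans T03.symm, κ, hκ0, ?_, ?_, ?_, ?_, ?_, ?_, ?_⟩
  · rw [s1, s2, hprod] at M1
    apply Complex.ofReal_injective
    apply mul_left_cancel₀ hb4
    rw [Complex.ofReal_mul, Complex.ofReal_mul, Complex.ofReal_mul (_ * _) (θ _), hκ, T01]
    rw [Complex.ofReal_mul ((v 0 - v 3) * _)]
    linear_combination lam * M1
  · rw [s1, s3, hprod] at M2
    apply Complex.ofReal_injective
    apply mul_left_cancel₀ hb4
    rw [Complex.ofReal_mul, Complex.ofReal_mul, Complex.ofReal_mul (_ * _) (θ _), hκ, T02]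
    rw [Complex.ofReal_mul (-((v 0 - v 3) * _)), Complex.ofReal_neg]
    linear_combination lam * M2
  · rw [s2, s3, hprod] at M3
    apply Complex.ofReal_injective
    apply mul_left_cancel₀ hb4
    rw [Complex.ofReal_mul, Complex.ofReal_mul, Complex.ofReal_mul (_ * _) (θ _), hκ, T03]
    rw [Complex.ofReal_mul ((v 0 - v 2) * _)]
    linear_combination lam * M3
  · apply Complex.ofReal_injective
    rw [Complex.ofReal_sub, Complex.ofReal_mul, T01, T02, hκ]
    linear_combination lam * s1
  · apply Complex.ofReal_injective
    rw [Complex.ofReal_sub, Complex.ofReal_mul, T01, T03, hκ]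
    linear_combination lam * s2
  · apply Complex.ofReal_injective
    rw [Complex.ofReal_sub, Complex.ofReal_mul, T02, T03, hκ]
    linear_combination lam * s3
  · rintro ⟨p1, p2, p3, p4, p5, p6⟩
    -- `d / (1 - d)² = -1 / |1 - d|²` turns the last moment identity into a sum of positive terms.
    obtain ⟨N, hN, hdN⟩ : ∃ N : Fin 4 → ℝ, (∀ i, 0 < N i) ∧ ∀ i, d i = -(1 - d i) ^ 2 * N i := by
      refine ⟨fun i => (Complex.normSq (1 - d i))⁻¹,
        fun i => inv_pos.mpr (Complex.normSq_pos.mpr (hd1 i)), fun i => ?_⟩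
      have h := Circle.one_sub_sq (c i)⁻¹
      rw [Circle.coe_inv, hdc] at h
      have hn : (Complex.normSq (1 - d i) : ℂ) ≠ 0 := by
        exact_mod_cast (Complex.normSq_pos.mpr (hd1 i)).ne'
      rw [h]
      push_cast
      field_simp
    have hB := Circle.one_sub_sq b
    have hBpos := Complex.normSq_pos.mpr hb1
    set S : ℝ := e₀₁ * (N 0 * N 1) + e₂₃ * (N 2 * N 3) + e₀₂ * (N 0 * N 2) + e₁₃ * (N 1 * N 3) +
      e₀₃ * (N 0 * N 3) + e₁₂ * (N 1 * N 2) with hS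
    have n0 := hN 0
    have n1 := hN 1
    have n2 := hN 2
    have n3 := hN 3
    have hSpos : 0 < S := by positivity
    have pair : ∀ i j, d i * d j = ((1 - d i) * (1 - d j)) ^ 2 * (N i * N j) := by
      intro i j
      calc d i * d j = (-(1 - d i) ^ 2 * N i) * (-(1 - d j) ^ 2 * N j) := by rw [← hdN, ← hdN]
        _ = _ := by ring
    rw [pair 0 1, pair 2 3, pair 0 2, pair 1 3, pair 0 3, pair 1 2, hB] at M4
    have key : θ b⁻¹ = κ * (Complex.normSq (1 - (b : ℂ)) * S) := by
      apply Complex.ofReal_injective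
      apply mul_left_cancel₀ (mul_ne_zero hb0 hY0)
      rw [Tb, Complex.ofReal_mul κ, hκ, hS]
      push_cast
      rw [hY] at M4 ⊢
      generalize 1 - d 0 = y₀ at *
      generalize 1 - d 1 = y₁ at *
      generalize 1 - d 2 = y₂ at *
      generalize 1 - d 3 = y₃ at *
      generalize (1 - (a₁ : ℂ)) * (1 - (a₂ : ℂ)) = A at *
      linear_combination -lam * M4
    rw [key]
    have : 0 < κ * κ := mul_self_pos.mpr hκ0
    calc 0 < κ * κ * (Complex.normSq (1 - (b : ℂ)) * S) := by positivity
      _ = _ := by ring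

/-! ### Signs of the minors -/

/-- The sign pattern of a definite form, for eigenvalues sorted by their coordinate. The weighted
row sums force two coordinates of each sign, and then `M1`, `M2`, `M3` give the signs of the `θᵢ`. -/
theorem signs_of_minors_pos {v₀ v₁ v₂ v₃ e₀₁ e₀₂ e₀₃ e₁₂ e₁₃ e₂₃ θ₁ θ₂ θ₃ θb κ : ℝ}
    (p01 : 0 < e₀₁) (p02 : 0 < e₀₂) (p03 : 0 < e₀₃) (p13 : 0 < e₁₃) (p23 : 0 < e₂₃)
    (v01 : v₀ < v₁) (v12 : v₁ < v₂) (v23 : v₂ < v₃) (n1 : v₁ ≠ 0) (n2 : v₂ ≠ 0)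
    (h0 : e₀₁ * v₁ + e₀₂ * v₂ + e₀₃ * v₃ = 0) (h1 : e₀₁ * v₀ + e₁₂ * v₂ + e₁₃ * v₃ = 0)
    (h2 : e₀₂ * v₀ + e₁₂ * v₁ + e₂₃ * v₃ = 0) (h3 : e₀₃ * v₀ + e₁₃ * v₁ + e₂₃ * v₂ = 0)
    (M1 : κ * (e₀₁ * v₀ * v₁) * ((v₀ - v₃) * (v₁ - v₂) * ((v₀ - v₂) * (v₁ - v₃))) =
        v₀ * v₁ * v₂ * v₃ * θ₁)
    (M2 : κ * (e₀₂ * v₀ * v₂) * (-((v₀ - v₃) * (v₁ - v₂)) * ((v₀ - v₁) * (v₂ - v₃))) =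
        v₀ * v₁ * v₂ * v₃ * θ₂)
    (M3 : κ * (e₀₃ * v₀ * v₃) * ((v₀ - v₂) * (v₁ - v₃) * ((v₀ - v₁) * (v₂ - v₃))) =
        v₀ * v₁ * v₂ * v₃ * θ₃)
    (hb : 0 < κ * θb) :
    (v₀ < 0 ∧ v₁ < 0 ∧ 0 < v₂ ∧ 0 < v₃) ∧ 0 < θb * θ₁ ∧ 0 < θb * θ₂ ∧ θb * θ₃ < 0 := by
  obtain ⟨g1, -, -, -⟩ := opposite_minors_eq h0 h1 h2 h3
  have hv0 : v₀ < 0 := by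
    by_contra h
    have : 0 < v₁ := by grind
    have : 0 < v₂ := by linarith
    have : 0 < v₃ := by linarith
    have : 0 < e₀₁ * v₁ + e₀₂ * v₂ + e₀₃ * v₃ := by positivity
    linarith
  have hv3 : 0 < v₃ := by
    by_contra h
    have : e₀₃ * v₀ < 0 := mul_neg_of_pos_of_neg p03 hv0
    have : e₁₃ * v₁ < 0 := mul_neg_of_pos_of_neg p13 (by linarith)
    have : e₂₃ * v₂ < 0 := mul_neg_of_pos_of_neg p23 (by linarith)
    linarith
  have hv1 : v₁ < 0 := by
    by_contra h
    have h1 : 0 < v₁ := lt_of_le_of_ne (not_lt.mp h) n1.symm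
    have h2 : 0 < v₂ := by linarith
    have : e₀₁ * v₀ * v₁ < 0 := mul_neg_of_neg_of_pos (mul_neg_of_pos_of_neg p01 hv0) h1
    have : 0 < e₂₃ * v₂ * v₃ := by positivity
    linarith
  have hv2 : 0 < v₂ := by
    by_contra h
    have h2 : v₂ < 0 := lt_of_le_of_ne (not_lt.mp h) n2
    have : 0 < e₀₁ * v₀ * v₁ := by
      rw [mul_assoc]; exact mul_pos p01 (mul_pos_of_neg_of_neg hv0 hv1)
    have : e₂₃ * v₂ * v₃ < 0 := mul_neg_of_neg_of_pos (mul_neg_of_pos_of_neg p23 h2) hv3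
    linarith
  have hP : 0 < v₀ * v₁ * v₂ * v₃ := mul_pos (mul_pos (mul_pos_of_neg_of_neg hv0 hv1) hv2) hv3
  have w1 : 0 < (v₀ - v₃) * (v₁ - v₂) :=
    mul_pos_of_neg_of_neg (by linarith) (by linarith)
  have w2 : 0 < (v₀ - v₂) * (v₁ - v₃) :=
    mul_pos_of_neg_of_neg (by linarith) (by linarith)
  have w3 : 0 < (v₀ - v₁) * (v₂ - v₃) :=
    mul_pos_of_neg_of_neg (by linarith) (by linarith)
  refine ⟨⟨hv0, hv1, hv2, hv3⟩, ?_, ?_, ?_⟩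
  · have : 0 < e₀₁ * v₀ * v₁ := by
      rw [mul_assoc]; exact mul_pos p01 (mul_pos_of_neg_of_neg hv0 hv1)
    refine pos_of_mul_pos_right (a := v₀ * v₁ * v₂ * v₃) ?_ hP.le
    rw [show v₀ * v₁ * v₂ * v₃ * (θb * θ₁) = θb * (v₀ * v₁ * v₂ * v₃ * θ₁) by ring, ← M1]
    have := mul_pos hb (mul_pos this (mul_pos w1 w2))
    linarith
  · have : 0 < -(e₀₂ * v₀ * v₂) := by
      rw [Left.neg_pos_iff]
      exact mul_neg_of_neg_of_pos (mul_neg_of_pos_of_neg p02 hv0) hv2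
    refine pos_of_mul_pos_right (a := v₀ * v₁ * v₂ * v₃) ?_ hP.le
    rw [show v₀ * v₁ * v₂ * v₃ * (θb * θ₂) = θb * (v₀ * v₁ * v₂ * v₃ * θ₂) by ring, ← M2]
    have := mul_pos hb (mul_pos this (mul_pos w1 w3))
    linarith
  · have : 0 < -(e₀₃ * v₀ * v₃) := by
      rw [Left.neg_pos_iff]
      exact mul_neg_of_neg_of_pos (mul_neg_of_pos_of_neg p03 hv0) hv3
    rw [← Left.neg_pos_iff]
    refine pos_of_mul_pos_right (a := v₀ * v₁ * v₂ * v₃) ?_ hP.le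
    rw [show v₀ * v₁ * v₂ * v₃ * -(θb * θ₃) = -(θb * (v₀ * v₁ * v₂ * v₃ * θ₃)) by ring, ← M3]
    have := mul_pos hb (mul_pos this (mul_pos w2 w3))
    linarith

/-- `θ₁ - θ₂` and `θ₁ - θ₃` have the same sign, whereas `θ₃` is separated from `θ₁` and `θ₂` by
`0`. Hence `θ₂` lies between `θ₁` and `θ₃`, which fixes the signs of all denominators. -/
theorem minors_same_sign {v₀ v₁ v₂ v₃ e₀₁ e₀₂ e₀₃ e₁₂ e₁₃ e₂₃ θ₁ θ₂ θ₃ κ : ℝ}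
    (v01 : 0 < v₀ * v₁) (v23 : 0 < v₂ * v₃) (v02 : v₀ * v₂ < 0)
    (g1 : e₂₃ * v₂ * v₃ = e₀₁ * v₀ * v₁) (g2 : e₁₃ * v₁ * v₃ = e₀₂ * v₀ * v₂)
    (g3 : e₁₂ * v₁ * v₂ = e₀₃ * v₀ * v₃) (hκ : κ ≠ 0)
    (M1 : κ * (e₀₁ * v₀ * v₁) * ((v₀ - v₃) * (v₁ - v₂) * ((v₀ - v₂) * (v₁ - v₃))) =
        v₀ * v₁ * v₂ * v₃ * θ₁)
    (M2 : κ * (e₀₂ * v₀ * v₂) * (-((v₀ - v₃) * (v₁ - v₂)) * ((v₀ - v₁) * (v₂ - v₃))) =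
        v₀ * v₁ * v₂ * v₃ * θ₂)
    (M3 : κ * (e₀₃ * v₀ * v₃) * ((v₀ - v₂) * (v₁ - v₃) * ((v₀ - v₁) * (v₂ - v₃))) =
        v₀ * v₁ * v₂ * v₃ * θ₃)
    (D12 : θ₁ - θ₂ = κ * ((v₀ - v₃) * (v₁ - v₂))) (D13 : θ₁ - θ₃ = κ * ((v₀ - v₂) * (v₁ - v₃)))
    (D23 : θ₂ - θ₃ = κ * ((v₀ - v₁) * (v₂ - v₃)))
    (t12 : 0 < θ₁ * θ₂) (t13 : θ₁ * θ₃ < 0) :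
    ∃ s : ℝ, 0 < s * e₀₁ ∧ 0 < s * e₀₂ ∧ 0 < s * e₀₃ ∧ 0 < s * e₁₂ ∧ 0 < s * e₁₃ ∧ 0 < s * e₂₃ := by
  have hw : 0 < ((v₀ - v₃) * (v₁ - v₂)) * ((v₀ - v₂) * (v₁ - v₃)) := by
    rcases pos_and_pos_or_neg_and_neg_of_mul_pos v01 with ⟨a, b⟩ | ⟨a, b⟩ <;>
    rcases pos_and_pos_or_neg_and_neg_of_mul_pos v23 with ⟨c, d⟩ | ⟨c, d⟩
    · nlinarith
    · exact mul_pos (mul_pos (by linarith) (by linarith)) (mul_pos (by linarith) (by linarith))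
    · exact mul_pos (mul_pos_of_neg_of_neg (by linarith) (by linarith))
        (mul_pos_of_neg_of_neg (by linarith) (by linarith))
    · nlinarith
  have hP : 0 < v₀ * v₁ * v₂ * v₃ := by
    have := mul_pos v01 v23
    linarith
  have hκ2 : 0 < κ * κ := mul_self_pos.mpr hκ
  have N1 : κ * κ * ((v₀ - v₃) * (v₁ - v₂) * ((v₀ - v₂) * (v₁ - v₃))) = (θ₁ - θ₂) * (θ₁ - θ₃) := by
    rw [D12, D13]; ring
  have N2 : κ * θ₁ * (e₀₂ * v₀ * v₂) * ((θ₁ - θ₂) * (θ₂ - θ₃)) =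
      -(κ * κ * (v₀ * v₁ * v₂ * v₃) * (θ₁ * θ₂)) := by
    rw [D12, D23]
    linear_combination -κ * κ * θ₁ * M2
  have N3 : κ * θ₁ * (e₀₃ * v₀ * v₃) * ((θ₁ - θ₃) * (θ₂ - θ₃)) =
      κ * κ * (v₀ * v₁ * v₂ * v₃) * (θ₁ * θ₃) := by
    rw [D13, D23]
    linear_combination κ * κ * θ₁ * M3
  have hord : 0 < (θ₁ - θ₂) * (θ₂ - θ₃) ∧ 0 < (θ₁ - θ₃) * (θ₂ - θ₃) := by
    have h := mul_pos hκ2 hw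
    rw [N1] at h
    rcases pos_and_pos_or_neg_and_neg_of_mul_pos t12 with ⟨a, b⟩ | ⟨a, b⟩
    · have c : θ₃ < 0 := neg_of_mul_neg_right t13 a.le
      have d : 0 < θ₁ - θ₂ := pos_of_mul_pos_left h (by linarith)
      exact ⟨mul_pos d (by linarith), mul_pos (by linarith) (by linarith)⟩
    · have c : 0 < θ₃ := pos_of_mul_neg_right t13 a.le
      have d : θ₁ - θ₂ < 0 := neg_of_mul_pos_left h (by linarith)
      exact ⟨mul_pos_of_neg_of_neg d (by linarith),
        mul_pos_of_neg_of_neg (by linarith) (by linarith)⟩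
  have hθ1 : 0 < θ₁ * θ₁ := mul_self_pos.mpr (by rintro rfl; simp at t12)
  have s1 : 0 < κ * θ₁ * (e₀₁ * v₀ * v₁) := by
    refine pos_of_mul_pos_left ?_ hw.le
    have := mul_pos hP hθ1
    linear_combination this - θ₁ * M1
  have s2 : κ * θ₁ * (e₀₂ * v₀ * v₂) < 0 := by
    refine neg_of_mul_neg_left ?_ hord.1.le
    rw [N2]
    exact neg_neg_of_pos (mul_pos (mul_pos hκ2 hP) t12)
  have s3 : κ * θ₁ * (e₀₃ * v₀ * v₃) < 0 := by
    refine neg_of_mul_neg_left ?_ hord.2.le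
    rw [N3]
    exact mul_neg_of_pos_of_neg (mul_pos hκ2 hP) t13
  have v13 : v₁ * v₃ < 0 := by
    rcases pos_and_pos_or_neg_and_neg_of_mul_pos v01 with ⟨a, b⟩ | ⟨a, b⟩
    · have c : v₂ < 0 := neg_of_mul_neg_right v02 a.le
      exact mul_neg_of_pos_of_neg b (neg_of_mul_pos_right v23 c.le)
    · have c : 0 < v₂ := pos_of_mul_neg_right v02 a.le
      exact mul_neg_of_neg_of_pos b (pos_of_mul_pos_right v23 c.le)
  have v12 : v₁ * v₂ < 0 := by
    refine neg_of_mul_neg_left (b := v₀ * v₀) ?_ (mul_self_nonneg _)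
    have := mul_neg_of_pos_of_neg v01 v02
    linarith
  have v03 : v₀ * v₃ < 0 := by
    refine neg_of_mul_neg_left (b := v₂ * v₂) ?_ (mul_self_nonneg _)
    have := mul_neg_of_neg_of_pos v02 v23
    linarith
  refine ⟨κ * θ₁, ?_, ?_, ?_, ?_, ?_, ?_⟩
  · refine pos_of_mul_pos_left (b := v₀ * v₁) ?_ v01.le
    linarith
  · refine pos_of_mul_neg_left (b := v₀ * v₂) ?_ v02.le
    linarith
  · refine pos_of_mul_neg_left (b := v₀ * v₃) ?_ v03.le
    linarith
  · refine pos_of_mul_neg_left (b := v₁ * v₂) ?_ v12.le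
    rw [← g3] at s3
    linarith
  · refine pos_of_mul_neg_left (b := v₁ * v₃) ?_ v13.le
    rw [← g2] at s2
    linarith
  · refine pos_of_mul_pos_left (b := v₂ * v₃) ?_ v23.le
    rw [← g1] at s1
    linarith

/-! ### Normal form of the triple -/

section NormalForm

open Matrix Module

variable {T₀ T₁ Tinf H : Matrix (Fin 4) (Fin 4) ℂ} {a₁ a₂ b : Circle} {c : Fin 4 → Circle}

theorem IsGII.eigenvalue_inv_ne (hT : IsGII a₁ a₂ b c T₀ T₁ Tinf)
    (hirr : IsIrreducibleTriple T₀ T₁ Tinf) (i : Fin 4) :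
    (c i : ℂ)⁻¹ ≠ 1 ∧ (c i : ℂ)⁻¹ ≠ b := by
  constructor
  · have h := hirr.spectrum_ne hT.prod_eq_one hT.spectrum_zero hT.spectrum_one hT.spectrum_inf
      (μ := 1) (i := 0) (j := 1) (k := i) (by simp) (by decide) (by simp)
    rwa [Ne, inv_eq_one]
  · have h := hirr.spectrum_ne hT.prod_eq_one hT.spectrum_zero hT.spectrum_one hT.spectrum_inf
      (μ := (b : ℂ)⁻¹) (i := 2) (j := 3) (k := i) (by simp) (by decide) (by simp)
    rwa [Ne, inv_eq_iff_eq_inv]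

theorem IsGII.det_relation (hT : IsGII a₁ a₂ b c T₀ T₁ Tinf) :
    (c 0 : ℂ)⁻¹ * (c 1 : ℂ)⁻¹ * (c 2 : ℂ)⁻¹ * (c 3 : ℂ)⁻¹ = (b : ℂ) ^ 2 * (a₁ * a₂) := by
  have hdet : T₀.det * T₁.det * Tinf.det = 1 := by
    rw [← Matrix.det_mul, ← Matrix.det_mul, hT.prod_eq_one, Matrix.det_one]
  have key : ∀ (T : Matrix (Fin 4) (Fin 4) ℂ) (d : Fin 4 → Circle), HasSemisimpleSpectrum T d →
      T.det = d 0 * d 1 * d 2 * d 3 := by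
    rintro T d ⟨P, rfl⟩
    rw [Matrix.det_units_conj, Matrix.det_diagonal, Fin.prod_univ_four]
  rw [key _ _ hT.spectrum_zero, key _ _ hT.spectrum_one, key _ _ hT.spectrum_inf] at hdet
  simp at hdet
  have h0 := (c 0).coe_ne_zero
  have h1 := (c 1).coe_ne_zero
  have h2 := (c 2).coe_ne_zero
  have h3 := (c 3).coe_ne_zero
  field_simp
  linear_combination -hdet

theorem HasSemisimpleSpectrum.exists_diagonalization {T : Matrix (Fin 4) (Fin 4) ℂ}
    {d : Fin 4 → Circle} (hT : HasSemisimpleSpectrum T d) :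
    ∃ P R : Matrix (Fin 4) (Fin 4) ℂ, P * R = 1 ∧ R * P = 1 ∧
      T = P * diagonal (fun i => (d i : ℂ)) * R := by
  obtain ⟨P, hP⟩ := hT
  exact ⟨P, _, by rw [← Units.val_mul, mul_inv_cancel, Units.val_one],
    by rw [← Units.val_mul, inv_mul_cancel, Units.val_one], hP⟩

/-- In an eigenbasis of `Tinf` (the columns of `P`) an invariant Hermitian form is diagonal and
`T₁ = 1 + (b - 1) B C`, where `B C` is the projection onto the `b`-eigenspace, factored through
`ℂ²`. That `T₀` has a two-dimensional fixed space is the vanishing of the compression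
`C ((1 - b)⁻¹ - (1 - Tinf⁻¹)⁻¹) B`. -/
theorem IsGII.exists_normalForm (hT : IsGII a₁ a₂ b c T₀ T₁ Tinf)
    (hc : ∀ i, (c i : ℂ)⁻¹ ≠ 1) (hH : IsInvariantHermitian T₀ T₁ Tinf H) :
    ∃ (P R : Matrix (Fin 4) (Fin 4) ℂ) (B : Matrix (Fin 4) (Fin 2) ℂ)
      (C : Matrix (Fin 2) (Fin 4) ℂ) (h : Fin 4 → ℝ), P * R = 1 ∧ R * P = 1 ∧
      Tinf = P * diagonal (fun i => (c i : ℂ)) * R ∧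
      T₁ = P * (1 + ((b : ℂ) - 1) • (B * C)) * R ∧
      T₀ = P * (diagonal (fun i => (c i : ℂ)⁻¹) * (1 + ((b : ℂ)⁻¹ - 1) • (B * C))) * R ∧
      C * B = 1 ∧
      C * diagonal (fun i => (1 - (b : ℂ))⁻¹ - (1 - (c i : ℂ)⁻¹)⁻¹) * B = 0 ∧
      Pᴴ * H * P = diagonal (fun i => (h i : ℂ)) ∧
      diagonal (fun i => (h i : ℂ)) * (B * C) = (B * C)ᴴ * diagonal (fun i => (h i : ℂ)) := by
  obtain ⟨P, R, hPR, hRP, hP⟩ := hT.spectrum_inf.exists_diagonalization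
  obtain ⟨P₁, R₁, hPR₁, hRP₁, hP₁⟩ := hT.spectrum_one.exists_diagonalization
  obtain ⟨P₀, R₀, hPR₀, hRP₀, hP₀⟩ := hT.spectrum_zero.exists_diagonalization
  have hb0 : (b : ℂ) ≠ 0 := b.coe_ne_zero
  have hb1 : (b : ℂ) - 1 ≠ 0 := sub_ne_zero.mpr fun h => hT.b_ne_one (Circle.ext h)
  have hGG : (R₁ * P) * (R * P₁) = 1 := by
    rw [Matrix.mul_assoc, ← Matrix.mul_assoc P, hPR, Matrix.one_mul, hRP₁]
  have hGG' : (R * P₁) * (R₁ * P) = 1 := mul_eq_one_comm.mp hGG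
  obtain ⟨B, hB⟩ : ∃ B : Matrix (Fin 4) (Fin 2) ℂ, B = (R * P₁).submatrix id ![2, 3] := ⟨_, rfl⟩
  obtain ⟨C, hC⟩ : ∃ C : Matrix (Fin 2) (Fin 4) ℂ, C = (R₁ * P).submatrix ![2, 3] id := ⟨_, rfl⟩
  have hCB : C * B = 1 := by
    rw [hC, hB, ← Matrix.submatrix_mul _ _ _ id _ Function.bijective_id, hGG]
    exact Matrix.submatrix_one _ (by decide)
  have hBC : (1 : Matrix (Fin 4) (Fin 4) ℂ) + ((b : ℂ) - 1) • (B * C) =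
      (R * P₁) * diagonal (fun i => ((![1, 1, b, b] : Fin 4 → Circle) i : ℂ)) * (R₁ * P) := by
    rw [← hGG', hB, hC]
    generalize R * P₁ = G
    generalize R₁ * P = G'
    ext i j
    rw [Matrix.add_apply, Matrix.smul_apply, Matrix.mul_apply, Matrix.mul_apply, Matrix.mul_apply]
    simp only [Matrix.mul_diagonal, Fin.sum_univ_four, Fin.sum_univ_two, Matrix.submatrix_apply]
    simp
    ring
  have e1 : T₁ = P * (1 + ((b : ℂ) - 1) • (B * C)) * R := by
    rw [hBC, hP₁]
    calc _ = (P * R) * P₁ * diagonal (fun i => ((![1, 1, b, b] : Fin 4 → Circle) i : ℂ)) * R₁ *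
            (P * R) := by rw [hPR, Matrix.one_mul, Matrix.mul_one]
      _ = _ := by simp only [Matrix.mul_assoc]
  have hQQ : B * C * (B * C) = B * C := by
    rw [Matrix.mul_assoc, ← Matrix.mul_assoc C, hCB, Matrix.one_mul]
  have hinv : (1 + ((b : ℂ)⁻¹ - 1) • (B * C)) * (1 + ((b : ℂ) - 1) • (B * C)) = 1 := by
    rw [Matrix.add_mul, Matrix.mul_add, Matrix.mul_add, Matrix.one_mul, Matrix.one_mul,
      Matrix.mul_one, Matrix.smul_mul, Matrix.mul_smul, hQQ, smul_smul]
    have : ((b : ℂ)⁻¹ - 1) * (b - 1) = -((b : ℂ) - 1) - ((b : ℂ)⁻¹ - 1) := by field_simp; ring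
    rw [this]
    module
  have hinv' := mul_eq_one_comm.mp hinv
  have hcc : diagonal (fun i => (c i : ℂ)) * diagonal (fun i => (c i : ℂ)⁻¹) = 1 := by
    rw [Matrix.diagonal_mul_diagonal, ← Matrix.diagonal_one]
    congr 1
    ext i
    exact mul_inv_cancel₀ (c i).coe_ne_zero
  have e0 : T₀ = P * (diagonal (fun i => (c i : ℂ)⁻¹) * (1 + ((b : ℂ)⁻¹ - 1) • (B * C))) * R := by
    have h1 : T₁ * Tinf * (P * (diagonal (fun i => (c i : ℂ)⁻¹) *
        (1 + ((b : ℂ)⁻¹ - 1) • (B * C))) * R) = 1 := by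
      rw [e1, hP]
      calc _ = P * (1 + ((b : ℂ) - 1) • (B * C)) * (R * P) *
              (diagonal (fun i => (c i : ℂ))) * (R * P) * (diagonal (fun i => (c i : ℂ)⁻¹) *
              (1 + ((b : ℂ)⁻¹ - 1) • (B * C))) * R := by simp only [Matrix.mul_assoc]
        _ = P * ((1 + ((b : ℂ) - 1) • (B * C)) *
              ((diagonal (fun i => (c i : ℂ)) * diagonal (fun i => (c i : ℂ)⁻¹)) *
              (1 + ((b : ℂ)⁻¹ - 1) • (B * C)))) * R := by
            rw [hRP]; simp only [Matrix.mul_assoc, Matrix.one_mul]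
        _ = 1 := by rw [hcc, Matrix.one_mul, hinv', Matrix.mul_one, hPR]
    have h2 := hT.prod_eq_one
    calc T₀ = T₀ * (T₁ * Tinf * (P * (diagonal (fun i => (c i : ℂ)⁻¹) *
        (1 + ((b : ℂ)⁻¹ - 1) • (B * C))) * R)) := by rw [h1, Matrix.mul_one]
      _ = (T₀ * T₁ * Tinf) * (P * (diagonal (fun i => (c i : ℂ)⁻¹) *
        (1 + ((b : ℂ)⁻¹ - 1) • (B * C))) * R) := by simp only [Matrix.mul_assoc]
      _ = _ := by rw [h2, Matrix.one_mul]
  -- The fixed space of `T₀` is spanned by the columns of `X`; `C X` is invertible because a fixed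
  -- vector killed by `C` is fixed by `Tinf⁻¹`.
  have hU : C * diagonal (fun i => (1 - (b : ℂ))⁻¹ - (1 - (c i : ℂ)⁻¹)⁻¹) * B = 0 := by
    obtain ⟨X, hX⟩ : ∃ X : Matrix (Fin 4) (Fin 2) ℂ, X = (R * P₀).submatrix id ![0, 1] := ⟨_, rfl⟩
    obtain ⟨X', hX'⟩ : ∃ X : Matrix (Fin 2) (Fin 4) ℂ, X = (R₀ * P).submatrix ![0, 1] id :=
      ⟨_, rfl⟩
    have hXX : X' * X = 1 := by
      rw [hX, hX', ← Matrix.submatrix_mul _ _ _ id _ Function.bijective_id, Matrix.mul_assoc,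
        ← Matrix.mul_assoc P, hPR, Matrix.one_mul, hRP₀]
      exact Matrix.submatrix_one _ (by decide)
    have hfix : diagonal (fun i => (c i : ℂ)⁻¹) * (1 + ((b : ℂ)⁻¹ - 1) • (B * C)) * X = X := by
      have h1 : diagonal (fun i => (c i : ℂ)⁻¹) * (1 + ((b : ℂ)⁻¹ - 1) • (B * C)) * (R * P₀) =
          (R * P₀) * diagonal (fun i => ((![1, 1, a₁, a₂] : Fin 4 → Circle) i : ℂ)) := by
        calc _ = (R * P) * (diagonal (fun i => (c i : ℂ)⁻¹) *
              (1 + ((b : ℂ)⁻¹ - 1) • (B * C))) * (R * P₀) := by rw [hRP, Matrix.one_mul]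
          _ = R * (P * (diagonal (fun i => (c i : ℂ)⁻¹) *
              (1 + ((b : ℂ)⁻¹ - 1) • (B * C))) * R) * P₀ := by simp only [Matrix.mul_assoc]
          _ = R * (P₀ * diagonal (fun i => ((![1, 1, a₁, a₂] : Fin 4 → Circle) i : ℂ)) *
              (R₀ * P₀)) := by rw [← e0, hP₀]; simp only [Matrix.mul_assoc]
          _ = _ := by rw [hRP₀, Matrix.mul_one, Matrix.mul_assoc]
      rw [hX]
      generalize R * P₀ = G at h1 ⊢
      ext i j
      have h2 := congrFun (congrFun h1 i) (![0, 1] j)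
      rw [Matrix.mul_diagonal] at h2
      rw [Matrix.submatrix_apply, id, Matrix.mul_apply] at *
      simp only [Matrix.submatrix_apply, id]
      rw [h2]
      fin_cases j <;> simp
    -- the resolvent of `Tinf⁻¹`
    have hres : diagonal (fun i => (1 - (c i : ℂ)⁻¹)⁻¹) * diagonal (fun i => (c i : ℂ)⁻¹) =
        diagonal (fun i => (1 - (c i : ℂ)⁻¹)⁻¹) - 1 := by
      rw [Matrix.diagonal_mul_diagonal, ← Matrix.diagonal_one, Matrix.diagonal_sub]
      congr 1
      ext i
      have : 1 - (c i : ℂ)⁻¹ ≠ 0 := sub_ne_zero.mpr (hc i).symm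
      rw [eq_sub_iff_add_eq]
      have h3 := inv_mul_cancel₀ this
      linear_combination -h3
    set N := diagonal (fun i => (1 - (c i : ℂ)⁻¹)⁻¹) with hN
    have hXN : X = ((b : ℂ)⁻¹ - 1) • ((N - 1) * B * (C * X)) := by
      have h3 := congrArg (N * ·) hfix
      simp only [← Matrix.mul_assoc, hres] at h3
      rw [Matrix.mul_add, Matrix.add_mul, Matrix.mul_one, Matrix.mul_smul, Matrix.smul_mul,
        Matrix.sub_mul N 1 X, Matrix.one_mul] at h3
      simp only [Matrix.mul_assoc] at h3 ⊢
      have h4 : X = N * X - (N * X - X) := by abel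
      rw [h4]
      nth_rw 1 [← h3]
      rw [← h4]
      abel
    have hY : (((b : ℂ)⁻¹ - 1) • (X' * (N - 1) * B)) * (C * X) = 1 := by
      rw [← hXX]
      refine Eq.trans ?_ (congrArg (X' * ·) hXN.symm)
      simp only [Matrix.smul_mul, Matrix.mul_smul, Matrix.mul_assoc]
    have hCX : (((b : ℂ)⁻¹ - 1) • (C * (N - 1) * B)) * (C * X) = C * X := by
      refine Eq.trans ?_ (congrArg (C * ·) hXN.symm)
      simp only [Matrix.smul_mul, Matrix.mul_smul, Matrix.mul_assoc]
    have hone : ((b : ℂ)⁻¹ - 1) • (C * (N - 1) * B) = 1 := by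
      have hY' := mul_eq_one_comm.mp hY
      calc _ = (((b : ℂ)⁻¹ - 1) • (C * (N - 1) * B)) * ((C * X) *
            (((b : ℂ)⁻¹ - 1) • (X' * (N - 1) * B))) := by rw [hY', Matrix.mul_one]
        _ = 1 := by rw [← Matrix.mul_assoc, hCX, hY']
    rw [Matrix.mul_sub, Matrix.sub_mul, Matrix.mul_one, hCB] at hone
    have hdiag : diagonal (fun i => (1 - (b : ℂ))⁻¹ - (1 - (c i : ℂ)⁻¹)⁻¹) =
        (1 - (b : ℂ))⁻¹ • (1 : Matrix (Fin 4) (Fin 4) ℂ) - N := by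
      rw [hN, ← Matrix.diagonal_one, ← Matrix.diagonal_smul, Matrix.diagonal_sub]
      congr 1
      ext i
      simp
    have hb2 : (b : ℂ)⁻¹ - 1 ≠ 0 := by
      rw [show (b : ℂ)⁻¹ - 1 = -(b - 1) / b by field_simp; ring]
      exact div_ne_zero (neg_ne_zero.mpr hb1) hb0
    have hCN : C * N * B = (((b : ℂ)⁻¹ - 1)⁻¹ + 1) • (1 : Matrix (Fin 2) (Fin 2) ℂ) := by
      rw [← eq_inv_smul_iff₀ hb2] at hone
      rw [add_smul, one_smul, ← hone]
      abel
    have hb3 : 1 - (b : ℂ) ≠ 0 := by rw [← neg_sub]; exact neg_ne_zero.mpr hb1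
    rw [hdiag, Matrix.mul_sub, Matrix.sub_mul, Matrix.mul_smul, Matrix.smul_mul, Matrix.mul_one, hCB,
      hCN, ← sub_smul]
    have : (1 - (b : ℂ))⁻¹ - (((b : ℂ)⁻¹ - 1)⁻¹ + 1) = 0 := by
      rw [show (b : ℂ)⁻¹ - 1 = (1 - b) / b by field_simp]
      field_simp
      ring
    rw [this, zero_smul]
  have conj_inv : ∀ S : Matrix (Fin 4) (Fin 4) ℂ, (P * S * R)ᴴ * H * (P * S * R) = H →
      Sᴴ * (Pᴴ * H * P) * S = Pᴴ * H * P := by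
    intro S hS
    have hPR' : Pᴴ * Rᴴ = 1 := by
      rw [← Matrix.conjTranspose_mul, hRP, Matrix.conjTranspose_one]
    calc _ = (Pᴴ * Rᴴ) * Sᴴ * (Pᴴ * H * P) * S * (R * P) := by
            rw [hRP, hPR', Matrix.one_mul, Matrix.mul_one]
      _ = Pᴴ * ((P * S * R)ᴴ * H * (P * S * R)) * P := by
            simp only [Matrix.conjTranspose_mul, Matrix.mul_assoc]
      _ = _ := by rw [hS]
  have i1 := conj_inv _ (by rw [← e1]; exact hH.inv_one)
  have i2 := conj_inv (diagonal (fun i => (c i : ℂ))) (by rw [← hP]; exact hH.inv_inf)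
  have hherm : (Pᴴ * H * P).IsHermitian :=
    Matrix.isHermitian_conjTranspose_mul_mul _ hH.isHermitian
  obtain ⟨K, hK⟩ : ∃ K, K = Pᴴ * H * P := ⟨_, rfl⟩
  rw [← hK] at i1 i2 hherm
  -- Eigenvectors of `Tinf` with distinct unimodular eigenvalues are orthogonal.
  have hKd : K = diagonal (fun i => ((K i i).re : ℂ)) := by
    ext i j
    by_cases hij : i = j
    · subst hij
      rw [Matrix.diagonal_apply_eq]
      exact (Complex.conj_eq_iff_re.mp (hherm.apply i i)).symm
    · rw [Matrix.diagonal_apply_ne _ hij]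
      have h := congrFun (congrFun i2 i) j
      rw [Matrix.diagonal_conjTranspose, Matrix.mul_diagonal, Matrix.diagonal_mul] at h
      have hs : star (fun i => (c i : ℂ)) i = (c i : ℂ)⁻¹ := Circle.conj_coe (c i)
      rw [hs] at h
      have hci := (c i).coe_ne_zero
      by_contra hne
      apply hij
      apply hT.c_injective
      apply Circle.ext
      field_simp at h
      exact h.symm
  refine ⟨P, R, B, C, fun i => (K i i).re, hPR, hRP, hP, e1, e0, hCB, hU, hK ▸ hKd, ?_⟩
  rw [← hKd]
  have hbb : star ((b : ℂ) - 1) = (b : ℂ)⁻¹ - 1 := by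
    rw [star_sub, star_one]
    exact congrArg (· - 1) (Circle.conj_coe b)
  have e2 : (1 + ((b : ℂ) - 1) • (B * C))ᴴ * K = K * (1 + ((b : ℂ)⁻¹ - 1) • (B * C)) := by
    calc _ = (1 + ((b : ℂ) - 1) • (B * C))ᴴ * K * ((1 + ((b : ℂ) - 1) • (B * C)) *
          (1 + ((b : ℂ)⁻¹ - 1) • (B * C))) := by rw [hinv', Matrix.mul_one]
      _ = _ := by rw [← Matrix.mul_assoc, i1]
  rw [Matrix.conjTranspose_add, Matrix.conjTranspose_one, Matrix.conjTranspose_smul, hbb,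
    Matrix.add_mul, Matrix.mul_add, Matrix.one_mul, Matrix.mul_one, add_right_inj,
    Matrix.smul_mul, Matrix.mul_smul] at e2
  have hb2 : (b : ℂ)⁻¹ - 1 ≠ 0 := by
    rw [← hbb]
    exact star_ne_zero.mpr hb1
  exact (smul_right_injective _ hb2 e2).symm

end NormalForm

/-! ### Definiteness and the arc conditions -/

section Definiteness

open Matrix Module

/-- Linear relations between the principal minors `tᵢ tⱼ - mᵢⱼ` of an idempotent of rank two
with diagonal `t` and `mᵢⱼ` the products of opposite entries, whose compression of the diagonal
matrix `v` vanishes. -/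
theorem minor_relations {t v : Fin 4 → ℝ} {m e : Fin 4 → Fin 4 → ℝ}
    (he : ∀ i j, e i j = t i * t j - m i j) (hsymm : ∀ i j, m i j = m j i)
    (hdiag : ∀ i, m i i = t i * t i) (r1 : ∀ i, m i 0 + m i 1 + m i 2 + m i 3 = t i)
    (r2 : ∀ i, m i 0 * v 0 + m i 1 * v 1 + m i 2 * v 2 + m i 3 * v 3 = 0)
    (r3 : t 0 + t 1 + t 2 + t 3 = 2) (r4 : t 0 * v 0 + t 1 * v 1 + t 2 * v 2 + t 3 * v 3 = 0) :
    (e 0 1 * v 1 + e 0 2 * v 2 + e 0 3 * v 3 = 0 ∧ e 0 1 * v 0 + e 1 2 * v 2 + e 1 3 * v 3 = 0 ∧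
      e 0 2 * v 0 + e 1 2 * v 1 + e 2 3 * v 3 = 0 ∧
      e 0 3 * v 0 + e 1 3 * v 1 + e 2 3 * v 2 = 0) ∧
    (t 0 = e 0 1 + e 0 2 + e 0 3 ∧ t 1 = e 0 1 + e 1 2 + e 1 3 ∧ t 2 = e 0 2 + e 1 2 + e 2 3 ∧
      t 3 = e 0 3 + e 1 3 + e 2 3) := by
  refine ⟨⟨?_, ?_, ?_, ?_⟩, ?_, ?_, ?_, ?_⟩
  · simp only [he]
    linear_combination t 0 * r4 - r2 0 + v 0 * hdiag 0
  · simp only [he, hsymm 0 1]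
    linear_combination t 1 * r4 - r2 1 + v 1 * hdiag 1
  · simp only [he, hsymm 0 2, hsymm 1 2]
    linear_combination t 2 * r4 - r2 2 + v 2 * hdiag 2
  · simp only [he, hsymm 0 3, hsymm 1 3, hsymm 2 3]
    linear_combination t 3 * r4 - r2 3 + v 3 * hdiag 3
  · simp only [he]
    linear_combination -t 0 * r3 + r1 0 - hdiag 0
  · simp only [he, hsymm 0 1]
    linear_combination -t 1 * r3 + r1 1 - hdiag 1
  · simp only [he, hsymm 0 2, hsymm 1 2]
    linear_combination -t 2 * r3 + r1 2 - hdiag 2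
  · simp only [he, hsymm 0 3, hsymm 1 3, hsymm 2 3]
    linear_combination -t 3 * r3 + r1 3 - hdiag 3

/-- If a minor vanishes, so do its complement and the products `tᵢ tⱼ - eᵢⱼ` of opposite entries
that link the two blocks. -/
theorem offBlock_eq_zero {e₀₁ e₀₂ e₀₃ e₁₂ e₁₃ e₂₃ u₀ u₁ u₂ u₃ t₀ t₁ t₂ t₃ : ℝ} (hu₂ : u₂ ≠ 0)
    (hu₃ : u₃ ≠ 0)
    (h0 : e₀₁ * u₁ + e₀₂ * u₂ + e₀₃ * u₃ = 0) (h1 : e₀₁ * u₀ + e₁₂ * u₂ + e₁₃ * u₃ = 0)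
    (g1 : e₂₃ * u₂ * u₃ = e₀₁ * u₀ * u₁)
    (q0 : t₀ = e₀₁ + e₀₂ + e₀₃) (q1 : t₁ = e₀₁ + e₁₂ + e₁₃) (q2 : t₂ = e₀₂ + e₁₂ + e₂₃)
    (q3 : t₃ = e₀₃ + e₁₃ + e₂₃) (hs : e₀₁ + e₀₂ + e₀₃ + e₁₂ + e₁₃ + e₂₃ = 1) (h01 : e₀₁ = 0) :
    t₀ * t₂ - e₀₂ = 0 ∧ t₀ * t₃ - e₀₃ = 0 ∧ t₁ * t₂ - e₁₂ = 0 ∧ t₁ * t₃ - e₁₃ = 0 := by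
  subst h01
  obtain rfl : e₂₃ = 0 := by simpa [hu₂, hu₃] using g1
  have hx : e₀₂ * e₁₃ - e₀₃ * e₁₂ = 0 := by
    apply mul_left_cancel₀ hu₂
    linear_combination e₁₃ * h0 - e₀₃ * h1
  subst q0 q1 q2 q3
  refine ⟨?_, ?_, ?_, ?_⟩
  · linear_combination e₀₂ * hs - hx
  · linear_combination e₀₃ * hs + hx
  · linear_combination e₁₂ * hs + hx
  · linear_combination e₁₃ * hs - hx

/-- If the minors `eᵢⱼ` are nonzero and `hᵢ hⱼ eᵢⱼ` is a nonnegative multiple of one real number `δ`,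
then the `hᵢ` have the same sign if and only if the minors are positive. -/
theorem same_sign_iff_minors_pos {h : Fin 4 → ℝ} {e : Fin 4 → Fin 4 → ℝ} {δ : ℝ}
    (hh : ∀ i, h i ≠ 0) (hδ : ∀ i j, ∃ r : ℝ, 0 ≤ r ∧ h i * h j * e i j = δ * r)
    (hδpos : (∀ i, 0 < h i) ∨ (∀ i, h i < 0) → 0 < δ) (n01 : e 0 1 ≠ 0) (n02 : e 0 2 ≠ 0)
    (n03 : e 0 3 ≠ 0) (n12 : e 1 2 ≠ 0) (n13 : e 1 3 ≠ 0) (n23 : e 2 3 ≠ 0) :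
    ((∀ i, 0 < h i) ∨ ∀ i, h i < 0) ↔
      0 < e 0 1 ∧ 0 < e 0 2 ∧ 0 < e 0 3 ∧ 0 < e 1 2 ∧ 0 < e 1 3 ∧ 0 < e 2 3 := by
  constructor
  · intro hsign
    have hd := hδpos hsign
    have hpos : ∀ i j, e i j ≠ 0 → 0 < e i j := fun i j hne => by
      obtain ⟨r, hr, hr'⟩ := hδ i j
      have hij : 0 < h i * h j := by
        rcases hsign with hg | hg
        · exact mul_pos (hg i) (hg j)
        · exact mul_pos_of_neg_of_neg (hg i) (hg j)
      refine lt_of_le_of_ne ?_ hne.symm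
      refine nonneg_of_mul_nonneg_right (a := h i * h j) ?_ hij
      rw [hr']
      positivity
    exact ⟨hpos _ _ n01, hpos _ _ n02, hpos _ _ n03, hpos _ _ n12, hpos _ _ n13, hpos _ _ n23⟩
  · rintro ⟨p01, p02, p03, p12, -, -⟩
    have hsg : ∀ i j, 0 < e i j → 0 < δ * (h i * h j) := fun i j hij => by
      obtain ⟨r, hr, hr'⟩ := hδ i j
      have hne : δ * r ≠ 0 := by
        rw [← hr']
        exact mul_ne_zero (mul_ne_zero (hh i) (hh j)) hij.ne'
      refine pos_of_mul_pos_left (b := e i j) ?_ hij.le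
      rw [mul_assoc, hr', ← mul_assoc]
      exact mul_pos (mul_self_pos.mpr (left_ne_zero_of_mul hne))
        (lt_of_le_of_ne hr (right_ne_zero_of_mul hne).symm)
    have s01 := hsg _ _ p01
    have s02 := hsg _ _ p02
    have s03 := hsg _ _ p03
    have s12 := hsg _ _ p12
    -- `δ³ (h₀ h₁ h₂)²` is positive
    have hd : 0 < δ := by
      by_contra hle
      have h1 := neg_of_mul_pos_right s01 (not_lt.mp hle)
      have h2 := neg_of_mul_pos_right s02 (not_lt.mp hle)
      have h3 := neg_of_mul_pos_right s12 (not_lt.mp hle)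
      have h4 := mul_pos_of_neg_of_neg h1 h2
      have h5 := mul_neg_of_pos_of_neg h4 h3
      have h6 := mul_self_nonneg (h 0 * h 1 * h 2)
      linarith
    have h1 := pos_of_mul_pos_right s01 hd.le
    have h2 := pos_of_mul_pos_right s02 hd.le
    have h3 := pos_of_mul_pos_right s03 hd.le
    rcases lt_or_gt_of_ne (hh 0) with h0 | h0
    · right
      intro i
      fin_cases i
      exacts [h0, neg_of_mul_pos_right h1 h0.le, neg_of_mul_pos_right h2 h0.le,
        neg_of_mul_pos_right h3 h0.le]
    · left
      intro i
      fin_cases i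
      exacts [h0, pos_of_mul_pos_right h1 h0.le, pos_of_mul_pos_right h2 h0.le,
        pos_of_mul_pos_right h3 h0.le]

variable {T₀ T₁ Tinf H : Matrix (Fin 4) (Fin 4) ℂ} {a₁ a₂ b : Circle} {c : Fin 4 → Circle}

/-- The entries of the projection `Q` that lead from one pair of eigenvectors of `Tinf` (the columns
of `P`) to the complementary pair do not all vanish: otherwise the span of the first pair would be
invariant. -/
theorem IsIrreducibleTriple.not_blockTriangular (hirr : IsIrreducibleTriple T₀ T₁ Tinf)
    {P R Q : Matrix (Fin 4) (Fin 4) ℂ} {d d' : Fin 4 → ℂ} {μ μ' : ℂ} (hRP : R * P = 1)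
    (h0 : T₀ = P * (diagonal d' * (1 + μ' • Q)) * R) (h1 : T₁ = P * (1 + μ • Q) * R)
    (hinf : Tinf = P * diagonal d * R) {S : Finset (Fin 4)} {i₀ i₁ j₀ j₁ : Fin 4}
    (hS : S = {i₀, i₁}) (hS' : Sᶜ = {j₀, j₁})
    (z1 : Q j₀ i₀ = 0) (z2 : Q j₀ i₁ = 0) (z3 : Q j₁ i₀ = 0) (z4 : Q j₁ i₁ = 0) : False := by
  have hi₀ : i₀ ∈ S := by simp [hS]
  have hi₁ : j₀ ∉ S := by
    rw [← Finset.mem_compl, hS']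
    simp
  have hQ : ∀ i ∉ S, ∀ j ∈ S, Q i j = 0 := by
    intro i hi j hj
    rw [← Finset.mem_compl, hS', Finset.mem_insert, Finset.mem_singleton] at hi
    rw [hS, Finset.mem_insert, Finset.mem_singleton] at hj
    rcases hi with rfl | rfl <;> rcases hj with rfl | rfl <;> assumption
  let W : Submodule ℂ (Fin 4 → ℂ) :=
    { carrier := {w | ∀ i ∉ S, (R *ᵥ w) i = 0}
      zero_mem' := fun i _ => by simp
      add_mem' := fun {x y} hx hy i hi => by
        rw [Matrix.mulVec_add, Pi.add_apply, hx i hi, hy i hi, add_zero]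
      smul_mem' := fun a x hx i hi => by
        rw [Matrix.mulVec_smul, Pi.smul_apply, hx i hi, smul_zero] }
  have hdiag : ∀ (d : Fin 4 → ℂ) (x : Fin 4 → ℂ), (∀ i ∉ S, x i = 0) →
      ∀ i ∉ S, (diagonal d *ᵥ x) i = 0 := fun d x hx i hi => by
    rw [Matrix.mulVec_diagonal, hx i hi, mul_zero]
  have hproj : ∀ (μ : ℂ) (x : Fin 4 → ℂ), (∀ i ∉ S, x i = 0) →
      ∀ i ∉ S, ((1 + μ • Q) *ᵥ x) i = 0 := fun μ x hx i hi => by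
    have hQx : (Q *ᵥ x) i = 0 := by
      change ∑ j, Q i j * x j = 0
      refine Finset.sum_eq_zero fun j _ => ?_
      by_cases hj : j ∈ S
      · rw [hQ i hi j hj, zero_mul]
      · rw [hx j hj, mul_zero]
    rw [Matrix.add_mulVec, Matrix.one_mulVec, Matrix.smul_mulVec, Pi.add_apply, Pi.smul_apply,
      hx i hi, hQx, smul_zero, add_zero]
  have hconj : ∀ (A : Matrix (Fin 4) (Fin 4) ℂ) (w : Fin 4 → ℂ),
      R *ᵥ ((P * A * R) *ᵥ w) = A *ᵥ (R *ᵥ w) := fun A w => by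
    rw [Matrix.mulVec_mulVec, Matrix.mulVec_mulVec, ← Matrix.mul_assoc, ← Matrix.mul_assoc, hRP,
      Matrix.one_mul]
  have hPe : ∀ i, R *ᵥ (P *ᵥ Pi.single i 1) = Pi.single i 1 := fun i => by
    rw [Matrix.mulVec_mulVec, hRP, Matrix.one_mulVec]
  rcases hirr W (fun w hw => ⟨fun i hi => by
      rw [h0, hconj, ← Matrix.mulVec_mulVec]
      exact hdiag _ _ (hproj _ _ hw) i hi, fun i hi => by
      rw [h1, hconj]
      exact hproj _ _ hw i hi, fun i hi => by
      rw [hinf, hconj]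
      exact hdiag _ _ hw i hi⟩) with h | h
  · have hmem : P *ᵥ Pi.single i₀ 1 ∈ W := fun i hi => by
      rw [hPe, Pi.single_eq_of_ne (by rintro rfl; exact hi hi₀)]
    rw [h, Submodule.mem_bot] at hmem
    have := congrFun (hPe i₀) i₀
    rw [hmem] at this
    simp at this
  · have hmem : P *ᵥ Pi.single j₀ 1 ∈ W := h ▸ Submodule.mem_top
    have := hmem j₀ hi₁
    rw [hPe] at this
    simp at this

/-- With `M = Bᴴ h B` one has `h (B C) = Cᴴ M C`. Hence up to the factor `det M` the principal
minors of `h (B C)` are absolute squares of the minors of `C`. -/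
theorem exists_minor_eq_normSq {B : Matrix (Fin 4) (Fin 2) ℂ} {C : Matrix (Fin 2) (Fin 4) ℂ}
    {h : Fin 4 → ℝ} (hCB : C * B = 1)
    (hQ : diagonal (fun i => (h i : ℂ)) * (B * C) = (B * C)ᴴ * diagonal (fun i => (h i : ℂ))) :
    ∃ δ : ℝ, (∀ i j, ∃ r : ℝ, 0 ≤ r ∧ (h i : ℂ) * h j * ((B * C) i i * (B * C) j j -
      (B * C) i j * (B * C) j i) = (δ * r : ℝ)) ∧
      ((∀ i, 0 < h i) ∨ (∀ i, h i < 0) → 0 < δ) := by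
  obtain ⟨M, hM⟩ : ∃ M, M = Bᴴ * diagonal (fun i => (h i : ℂ)) * B := ⟨_, rfl⟩
  have hBinj : Function.Injective B.mulVec := by
    intro x y hxy
    have := congrArg (C *ᵥ ·) hxy
    simpa only [Matrix.mulVec_mulVec, hCB, Matrix.one_mulVec] using this
  have hherm : (diagonal (fun i => (h i : ℂ))).IsHermitian :=
    Matrix.isHermitian_diagonal_of_self_adjoint _ (by
      ext i
      exact Complex.conj_ofReal (h i))
  have hMherm : M.IsHermitian := hM ▸ Matrix.isHermitian_conjTranspose_mul_mul B hherm
  have hdet : (M.det.re : ℂ) = M.det := by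
    rw [← Complex.conj_eq_iff_re]
    change star M.det = M.det
    rw [← Matrix.det_conjTranspose, hMherm.eq]
  have hfac : diagonal (fun i => (h i : ℂ)) * (B * C) = Cᴴ * M * C := by
    calc _ = diagonal (fun i => (h i : ℂ)) * (B * C) * (B * C) := by
          rw [Matrix.mul_assoc, Matrix.mul_assoc B, ← Matrix.mul_assoc C, hCB, Matrix.one_mul]
      _ = (B * C)ᴴ * diagonal (fun i => (h i : ℂ)) * (B * C) := by rw [hQ]
      _ = _ := by rw [hM, Matrix.conjTranspose_mul]; simp only [Matrix.mul_assoc]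
  refine ⟨M.det.re, fun i j => ⟨Complex.normSq (C 0 i * C 1 j - C 0 j * C 1 i),
    Complex.normSq_nonneg _, ?_⟩, ?_⟩
  · have entry : ∀ i j, (h i : ℂ) * (B * C) i j =
        (starRingEnd ℂ (C 0 i) * M 0 0 + starRingEnd ℂ (C 1 i) * M 1 0) * C 0 j +
        (starRingEnd ℂ (C 0 i) * M 0 1 + starRingEnd ℂ (C 1 i) * M 1 1) * C 1 j := by
      intro i j
      have := congrFun (congrFun hfac i) j
      rw [Matrix.diagonal_mul] at this
      rw [this, Matrix.mul_apply, Fin.sum_univ_two, Matrix.mul_apply, Matrix.mul_apply,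
        Fin.sum_univ_two, Fin.sum_univ_two]
      rfl
    rw [Complex.ofReal_mul, hdet, ← Complex.mul_conj, Matrix.det_fin_two]
    have e1 := entry i i
    have e2 := entry j j
    have e3 := entry i j
    have e4 := entry j i
    calc _ = ((h i : ℂ) * (B * C) i i) * (h j * (B * C) j j) -
          ((h i : ℂ) * (B * C) i j) * (h j * (B * C) j i) := by ring
      _ = _ := by
        rw [e1, e2, e3, e4]
        simp only [map_sub, map_mul]
        ring
  · have pos : ∀ g : Fin 4 → ℝ, (∀ i, 0 < g i) →
        0 < (Bᴴ * diagonal (fun i => (g i : ℂ)) * B).det := by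
      intro g hg
      have hD : (diagonal (fun i => (g i : ℂ))).PosDef :=
        Matrix.posDef_diagonal_iff.mpr fun i => by exact_mod_cast hg i
      exact (hD.conjTranspose_mul_mul_same hBinj).det_pos
    have hpos : 0 < M.det → 0 < M.det.re := fun h' => (Complex.lt_def.mp h').1
    rintro (hh | hh)
    · exact hpos (hM ▸ pos h hh)
    · have := pos (fun i => -h i) fun i => neg_pos.mpr (hh i)
      have hneg : diagonal (fun i => ((-h i : ℝ) : ℂ)) = -diagonal (fun i => (h i : ℂ)) := by
        rw [Matrix.diagonal_neg]
        congr 1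
        ext i
        simp
      rw [hneg, Matrix.mul_neg, Matrix.neg_mul, ← hM, Matrix.det_neg] at this
      simp only [Fintype.card_fin, even_two, Even.neg_pow, one_pow, one_mul] at this
      exact hpos this

theorem isDefinite_iff_of_conj_diagonal {P R : Matrix (Fin 4) (Fin 4) ℂ} {h : Fin 4 → ℝ}
    (hPR : P * R = 1) (hP : Pᴴ * H * P = diagonal (fun i => (h i : ℂ))) :
    IsDefinite H ↔ (∀ i, 0 < h i) ∨ ∀ i, h i < 0 := by
  have hU : IsUnit P := IsUnit.of_mul_eq_one _ hPR
  have hN : Pᴴ * (-H) * P = diagonal (fun i => ((-h i : ℝ) : ℂ)) := by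
    rw [Matrix.mul_neg, Matrix.neg_mul, hP, Matrix.diagonal_neg]
    congr 1
    ext i
    simp
  rw [IsDefinite, ← Matrix.IsUnit.posDef_star_left_conjugate_iff hU (x := H),
    ← Matrix.IsUnit.posDef_star_left_conjugate_iff hU (x := -H), Matrix.star_eq_conjTranspose, hP,
    hN, Matrix.posDef_diagonal_iff, Matrix.posDef_diagonal_iff]
  simp only [Complex.zero_lt_real, Left.neg_pos_iff]

/-- The principal `2 × 2` minors `e i j` of the projection onto the `b`-eigenspace of `T₁`, in an
eigenbasis of `Tinf`. They are real, satisfy linear relations whose coefficients come from the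
spectra, and their signs decide the definiteness of the invariant form. -/
theorem IsGII.exists_minors (hT : IsGII a₁ a₂ b c T₀ T₁ Tinf)
    (hirr : IsIrreducibleTriple T₀ T₁ Tinf) (hH0 : H ≠ 0)
    (hH : IsInvariantHermitian T₀ T₁ Tinf H) {v : Fin 4 → ℝ} (hv : ∀ i, v i = cotCoord b (c i)) :
    ∃ e₀₁ e₀₂ e₀₃ e₁₂ e₁₃ e₂₃ : ℝ,
      (e₀₁ * v 1 + e₀₂ * v 2 + e₀₃ * v 3 = 0 ∧ e₀₁ * v 0 + e₁₂ * v 2 + e₁₃ * v 3 = 0 ∧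
      e₀₂ * v 0 + e₁₂ * v 1 + e₂₃ * v 3 = 0 ∧ e₀₃ * v 0 + e₁₃ * v 1 + e₂₃ * v 2 = 0) ∧
      e₀₁ + e₀₂ + e₀₃ + e₁₂ + e₁₃ + e₂₃ = 1 ∧
      (1 - (b : ℂ)) * (e₀₁ * ((c 0 : ℂ)⁻¹ + (c 1 : ℂ)⁻¹) + e₀₂ * ((c 0 : ℂ)⁻¹ + (c 2 : ℂ)⁻¹) +
        e₀₃ * ((c 0 : ℂ)⁻¹ + (c 3 : ℂ)⁻¹) + e₁₂ * ((c 1 : ℂ)⁻¹ + (c 2 : ℂ)⁻¹) +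
        e₁₃ * ((c 1 : ℂ)⁻¹ + (c 3 : ℂ)⁻¹) + e₂₃ * ((c 2 : ℂ)⁻¹ + (c 3 : ℂ)⁻¹)) =
        b * (2 + a₁ + a₂ - ((c 0 : ℂ)⁻¹ + (c 1 : ℂ)⁻¹ + (c 2 : ℂ)⁻¹ + (c 3 : ℂ)⁻¹)) ∧
      (e₀₁ ≠ 0 ∧ e₀₂ ≠ 0 ∧ e₀₃ ≠ 0) ∧
      (IsDefinite H ↔ 0 < e₀₁ ∧ 0 < e₀₂ ∧ 0 < e₀₃ ∧ 0 < e₁₂ ∧ 0 < e₁₃ ∧ 0 < e₂₃) := by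
  have hb : (b : ℂ) ≠ 1 := fun h => hT.b_ne_one (Circle.ext h)
  have hb0 : (b : ℂ) ≠ 0 := b.coe_ne_zero
  have hc1 := fun i => (hT.eigenvalue_inv_ne hirr i).1
  have hvI : ∀ i, (v i : ℂ) * Complex.I = (1 - (b : ℂ))⁻¹ - (1 - (c i : ℂ)⁻¹)⁻¹ := fun i => by
    rw [hv, cotCoord_mul_I hb (hc1 i)]
  have hv0 : ∀ i, v i ≠ 0 := fun i h => by
    have h1 := hvI i
    rw [h, Complex.ofReal_zero, zero_mul] at h1
    have h2 := inv_injective (sub_eq_zero.mp h1.symm)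
    exact (hT.eigenvalue_inv_ne hirr i).2 (sub_right_injective h2).symm
  obtain ⟨P, R, B, C, h, hPR, hRP, einf, e1, e0, hCB, hU, hP, hQ⟩ := hT.exists_normalForm hc1 hH
  have hdefh := isDefinite_iff_of_conj_diagonal hPR hP
  obtain ⟨δ, hδ, hδpos⟩ := exists_minor_eq_normSq hCB hQ
  have hh : ∀ i, h i ≠ 0 := by
    intro i hi
    refine hH0 (hirr.form_eq_zero_of_mulVec_eq_zero hT.prod_eq_one hH.inv_zero hH.inv_one hH.inv_inf
      (x := P *ᵥ Pi.single i 1) (fun h0 => ?_) ?_)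
    · have := congrArg (R *ᵥ ·) h0
      simp only [Matrix.mulVec_mulVec, hRP, Matrix.one_mulVec, Matrix.mulVec_zero] at this
      simpa using congrFun this i
    · have hRPH : Rᴴ * Pᴴ = 1 := by
        rw [← Matrix.conjTranspose_mul, hPR, Matrix.conjTranspose_one]
      calc H *ᵥ (P *ᵥ Pi.single i 1) = (Rᴴ * (Pᴴ * H * P)) *ᵥ Pi.single i 1 := by
            rw [Matrix.mulVec_mulVec, ← Matrix.mul_assoc, ← Matrix.mul_assoc, hRPH, Matrix.one_mul]
        _ = 0 := by
            rw [hP, ← Matrix.mulVec_mulVec, Matrix.diagonal_mulVec_single, hi]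
            simp
  have hQQ : B * C * (B * C) = B * C := by
    rw [Matrix.mul_assoc, ← Matrix.mul_assoc C, hCB, Matrix.one_mul]
  have hQU : B * C * diagonal (fun i => (v i : ℂ) * Complex.I) * (B * C) = 0 := by
    simp only [hvI]
    calc _ = B * (C * diagonal (fun i => (1 - (b : ℂ))⁻¹ - (1 - (c i : ℂ)⁻¹)⁻¹) * B) * C := by
          simp only [Matrix.mul_assoc]
      _ = 0 := by rw [hU]; simp
  have htr : (B * C).trace = 2 := by
    rw [Matrix.trace_mul_comm, hCB]
    simp
  have htrU : (diagonal (fun i => (v i : ℂ) * Complex.I) * (B * C)).trace = 0 := by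
    simp only [hvI]
    rw [← Matrix.mul_assoc, Matrix.trace_mul_comm, ← Matrix.mul_assoc, hU, Matrix.trace_zero]
  have htr0 : (diagonal (fun i => (c i : ℂ)⁻¹) * (1 + ((b : ℂ)⁻¹ - 1) • (B * C))).trace =
      2 + (a₁ : ℂ) + a₂ := by
    obtain ⟨P₀, R₀, -, hRP₀, h0⟩ := hT.spectrum_zero.exists_diagonalization
    have t1 : T₀.trace = 2 + (a₁ : ℂ) + a₂ := by
      rw [h0, Matrix.mul_assoc, Matrix.trace_mul_comm, Matrix.mul_assoc, hRP₀, Matrix.mul_one,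
        Matrix.trace_diagonal, Fin.sum_univ_four]
      simp
      ring
    rw [← t1, e0, Matrix.trace_mul_comm (P * _), ← Matrix.mul_assoc, hRP, Matrix.one_mul]
  obtain ⟨Q, hQdef⟩ : ∃ Q, Q = B * C := ⟨_, rfl⟩
  rw [← hQdef] at e0 e1 hQ hδ hQQ hQU htr htrU htr0
  have hsymm : ∀ i j, (h i : ℂ) * Q i j = starRingEnd ℂ (Q j i) * h j := fun i j => by
    have := congrFun (congrFun hQ i) j
    rwa [Matrix.diagonal_mul, Matrix.mul_diagonal] at this
  have hhc : ∀ i, (h i : ℂ) ≠ 0 := fun i => by exact_mod_cast hh i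
  obtain ⟨t, ht⟩ : ∃ t : Fin 4 → ℝ, ∀ i, Q i i = t i := by
    refine ⟨fun i => (Q i i).re, fun i => (Complex.conj_eq_iff_re.mp ?_).symm⟩
    apply mul_right_cancel₀ (hhc i)
    rw [← hsymm, mul_comm]
  obtain ⟨m, hm⟩ : ∃ m : Fin 4 → Fin 4 → ℝ, ∀ i j, Q i j * Q j i = m i j := by
    refine ⟨fun i j => (Q i j * Q j i).re, fun i j => (Complex.conj_eq_iff_re.mp ?_).symm⟩
    apply mul_right_cancel₀ (mul_ne_zero (hhc i) (hhc j))
    rw [map_mul]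
    calc _ = (starRingEnd ℂ (Q i j) * h i) * (starRingEnd ℂ (Q j i) * h j) := by ring
      _ = _ := by rw [← hsymm, ← hsymm]; ring
  have hmsymm : ∀ i j, m i j = m j i := fun i j => by
    apply Complex.ofReal_injective
    rw [← hm, ← hm, mul_comm]
  have hmdiag : ∀ i, m i i = t i * t i := fun i => by
    apply Complex.ofReal_injective
    rw [← hm, ht, Complex.ofReal_mul]
  have r1 : ∀ i, m i 0 + m i 1 + m i 2 + m i 3 = t i := fun i => by
    apply Complex.ofReal_injective
    have := congrFun (congrFun hQQ i) i
    rw [Matrix.mul_apply, Fin.sum_univ_four] at this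
    push_cast
    rw [← ht, ← this, hm, hm, hm, hm]
  have r2 : ∀ i, m i 0 * v 0 + m i 1 * v 1 + m i 2 * v 2 + m i 3 * v 3 = 0 := fun i => by
    apply Complex.ofReal_injective
    have := congrFun (congrFun hQU i) i
    rw [Matrix.mul_apply, Fin.sum_univ_four] at this
    simp only [Matrix.mul_diagonal, Matrix.zero_apply] at this
    push_cast
    rw [← hm, ← hm, ← hm, ← hm]
    apply mul_left_cancel₀ Complex.I_ne_zero
    rw [mul_zero, ← this]
    ring
  have r3 : t 0 + t 1 + t 2 + t 3 = 2 := by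
    apply Complex.ofReal_injective
    rw [Matrix.trace, Fin.sum_univ_four] at htr
    simp only [Matrix.diag_apply, ht] at htr
    exact_mod_cast htr
  have r4 : t 0 * v 0 + t 1 * v 1 + t 2 * v 2 + t 3 * v 3 = 0 := by
    apply Complex.ofReal_injective
    rw [Matrix.trace, Fin.sum_univ_four] at htrU
    simp only [Matrix.diag_apply, Matrix.diagonal_mul, ht] at htrU
    apply mul_left_cancel₀ Complex.I_ne_zero
    push_cast
    rw [mul_zero, ← htrU]
    ring
  have r5 : (1 - (b : ℂ)) * ((c 0 : ℂ)⁻¹ * t 0 + (c 1 : ℂ)⁻¹ * t 1 + (c 2 : ℂ)⁻¹ * t 2 +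
      (c 3 : ℂ)⁻¹ * t 3) =
      b * (2 + a₁ + a₂ - ((c 0 : ℂ)⁻¹ + (c 1 : ℂ)⁻¹ + (c 2 : ℂ)⁻¹ + (c 3 : ℂ)⁻¹)) := by
    rw [← htr0, Matrix.trace, Fin.sum_univ_four]
    simp only [Matrix.diag_apply, Matrix.diagonal_mul, Matrix.add_apply, Matrix.one_apply_eq,
      Matrix.smul_apply, ht, smul_eq_mul]
    have hbb := mul_inv_cancel₀ hb0
    linear_combination -((c 0 : ℂ)⁻¹ * t 0 + (c 1 : ℂ)⁻¹ * t 1 + (c 2 : ℂ)⁻¹ * t 2 +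
      (c 3 : ℂ)⁻¹ * t 3) * hbb
  obtain ⟨e, he⟩ : ∃ e : Fin 4 → Fin 4 → ℝ, ∀ i j, e i j = t i * t j - m i j := ⟨_, fun _ _ => rfl⟩
  obtain ⟨⟨w0, w1, w2, w3⟩, q0, q1, q2, q3⟩ := minor_relations he hmsymm hmdiag r1 r2 r3 r4
  have hs : e 0 1 + e 0 2 + e 0 3 + e 1 2 + e 1 3 + e 2 3 = 1 := by linarith
  obtain ⟨g1, g2, g3, -⟩ := opposite_minors_eq w0 w1 w2 w3
  -- A vanishing product of opposite entries makes both entries vanish, by Hermitian symmetry.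
  have hzero : ∀ i j, t i * t j - e i j = 0 → Q i j = 0 ∧ Q j i = 0 := by
    intro i j hij
    have h1 : Q i j * Q j i = 0 := by
      rw [hm, show m i j = t i * t j - e i j by rw [he]; ring, hij, Complex.ofReal_zero]
    have h2 : Q i j = 0 ↔ Q j i = 0 := by
      have := hsymm i j
      constructor
      · intro h0
        rw [h0, mul_zero, eq_comm, mul_eq_zero] at this
        simpa using this.resolve_right (hhc j)
      · intro h0
        rw [h0, map_zero, zero_mul, mul_eq_zero] at this
        exact this.resolve_left (hhc i)
    rcases mul_eq_zero.mp h1 with h0 | h0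
    · exact ⟨h0, h2.mp h0⟩
    · exact ⟨h2.mpr h0, h0⟩
  have n01 : e 0 1 ≠ 0 := by
    intro h01
    obtain ⟨z1, z2, z3, z4⟩ := offBlock_eq_zero (hv0 2) (hv0 3) w0 w1 g1 q0 q1 q2 q3 hs h01
    exact hirr.not_blockTriangular hRP e0 e1 einf (S := {0, 1}) (i₀ := 0) (i₁ := 1) (j₀ := 2)
      (j₁ := 3) rfl (by decide) (hzero _ _ z1).2 (hzero _ _ z3).2 (hzero _ _ z2).2 (hzero _ _ z4).2
  have n02 : e 0 2 ≠ 0 := by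
    intro h02
    obtain ⟨z1, z2, z3, z4⟩ := offBlock_eq_zero (e₀₁ := e 0 2) (e₀₂ := e 0 1) (e₀₃ := e 0 3)
      (e₁₂ := e 1 2) (e₁₃ := e 2 3) (e₂₃ := e 1 3) (u₀ := v 0) (u₁ := v 2) (t₀ := t 0) (t₁ := t 2)
      (t₂ := t 1) (t₃ := t 3) (hv0 1) (hv0 3) (by linarith) (by linarith) g2 (by linarith)
      (by linarith) (by linarith) (by linarith) (by linarith) h02
    exact hirr.not_blockTriangular hRP e0 e1 einf (S := {0, 2}) (i₀ := 0) (i₁ := 2) (j₀ := 1)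
      (j₁ := 3) rfl (by decide) (hzero _ _ z1).2 (hzero 1 2 (by linarith)).1 (hzero _ _ z2).2
      (hzero _ _ z4).2
  have n03 : e 0 3 ≠ 0 := by
    intro h03
    obtain ⟨z1, z2, z3, z4⟩ := offBlock_eq_zero (e₀₁ := e 0 3) (e₀₂ := e 0 1) (e₀₃ := e 0 2)
      (e₁₂ := e 1 3) (e₁₃ := e 2 3) (e₂₃ := e 1 2) (u₀ := v 0) (u₁ := v 3) (t₀ := t 0) (t₁ := t 3)
      (t₂ := t 1) (t₃ := t 2) (hv0 1) (hv0 2) (by linarith) (by linarith) g3 (by linarith)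
      (by linarith) (by linarith) (by linarith) (by linarith) h03
    exact hirr.not_blockTriangular hRP e0 e1 einf (S := {0, 3}) (i₀ := 0) (i₁ := 3) (j₀ := 1)
      (j₁ := 2) rfl (by decide) (hzero _ _ z1).2 (hzero 1 3 (by linarith)).1 (hzero _ _ z2).2
      (hzero 2 3 (by linarith)).1
  have hδ' : ∀ i j, ∃ r : ℝ, 0 ≤ r ∧ h i * h j * e i j = δ * r := fun i j => by
    obtain ⟨r, hr, hr'⟩ := hδ i j
    refine ⟨r, hr, ?_⟩
    apply Complex.ofReal_injective
    rw [← hr', he, ht, ht, hm]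
    push_cast
    ring
  refine ⟨e 0 1, e 0 2, e 0 3, e 1 2, e 1 3, e 2 3, ⟨w0, w1, w2, w3⟩, hs, ?_, ⟨n01, n02, n03⟩, ?_⟩
  · rw [← r5, q0, q1, q2, q3]
    push_cast
    ring
  · have nz : ∀ x y z : ℝ, x * y * z ≠ 0 → x ≠ 0 := fun x y z hx h0 => hx (by rw [h0]; ring)
    exact hdefh.trans (same_sign_iff_minors_pos hh hδ' hδpos n01 n02 n03
      (nz _ _ _ (g3.trans_ne (mul_ne_zero (mul_ne_zero n03 (hv0 _)) (hv0 _))))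
      (nz _ _ _ (g2.trans_ne (mul_ne_zero (mul_ne_zero n02 (hv0 _)) (hv0 _))))
      (nz _ _ _ (g1.trans_ne (mul_ne_zero (mul_ne_zero n01 (hv0 _)) (hv0 _)))))

theorem IsGII.comp_perm (hT : IsGII a₁ a₂ b c T₀ T₁ Tinf) (σ : Equiv.Perm (Fin 4)) :
    IsGII a₁ a₂ b (c ∘ σ) T₀ T₁ Tinf := by
  refine { hT with c_injective := hT.c_injective.comp σ.injective, spectrum_inf := ?_ }
  obtain ⟨P, R, hPR, hRP, h⟩ := hT.spectrum_inf.exists_diagonalization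
  refine ⟨⟨P.submatrix id σ, R.submatrix σ id, ?_, ?_⟩, ?_⟩
  · rw [Matrix.submatrix_mul_equiv, hPR, Matrix.submatrix_id_id]
  · rw [← Matrix.submatrix_mul _ _ _ id _ Function.bijective_id, hRP]
    exact Matrix.submatrix_one _ σ.injective
  · change Tinf = P.submatrix id σ * diagonal ((fun i => (c i : ℂ)) ∘ σ) * R.submatrix σ id
    rw [← Matrix.submatrix_diagonal_equiv, Matrix.submatrix_mul_equiv, Matrix.submatrix_mul_equiv,
      Matrix.submatrix_id_id, h]

/-- The necessity of the arc conditions, for eigenvalues sorted by `cotCoord b`. The values of `θ`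
are compared with that at `b⁻¹` because `b⁻¹` marks the arc `I₂`. -/
theorem IsGII.signs_of_isDefinite (hT : IsGII a₁ a₂ b c T₀ T₁ Tinf)
    (hirr : IsIrreducibleTriple T₀ T₁ Tinf) (hH0 : H ≠ 0)
    (hH : IsInvariantHermitian T₀ T₁ Tinf H) {θ : Circle → ℝ}
    (hθ : ∀ z, θ z = orient (b⁻¹ * a₁⁻¹) z (b⁻¹ * a₂⁻¹))
    (hmono : Monotone fun i => cotCoord b (c i)) (hdef : IsDefinite H) :
    (cotCoord b (c 0) < 0 ∧ cotCoord b (c 1) < 0 ∧ 0 < cotCoord b (c 2) ∧ 0 < cotCoord b (c 3)) ∧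
      (0 < θ b⁻¹ * θ (c 0 * c 1) ∧ 0 < θ b⁻¹ * θ (c 2 * c 3) ∧ 0 < θ b⁻¹ * θ (c 0 * c 2) ∧
        0 < θ b⁻¹ * θ (c 1 * c 3) ∧ θ b⁻¹ * θ (c 0 * c 3) < 0 ∧ θ b⁻¹ * θ (c 1 * c 2) < 0) := by
  have hb1 : (b : ℂ) ≠ 1 := fun h => hT.b_ne_one (Circle.ext h)
  obtain ⟨v, hv⟩ : ∃ v : Fin 4 → ℝ, ∀ i, v i = cotCoord b (c i) := ⟨_, fun _ => rfl⟩
  simp only [← hv] at hmono ⊢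
  obtain ⟨e₀₁, e₀₂, e₀₃, e₁₂, e₁₃, e₂₃, ⟨h0, h1, h2, h3⟩, hs, ht, -, hiff⟩ :=
    hT.exists_minors hirr hH0 hH hv
  obtain ⟨hv0, hvinj, t1, t2, t3, κ, -, M1, M2, M3, -, -, -, hκ⟩ :=
    real_moments hb1 hT.a₁_ne_a₂ (fun i => (hT.eigenvalue_inv_ne hirr i).1)
      (fun i => (hT.eigenvalue_inv_ne hirr i).2) hT.c_injective hT.det_relation hv hθ h0 h1 h2 h3
      hs ht
  have hstrict : StrictMono v := hmono.strictMono_of_injective hvinj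
  obtain ⟨p01, p02, p03, p12, p13, p23⟩ := hiff.mp hdef
  obtain ⟨hsv, s1, s2, s3⟩ := signs_of_minors_pos p01 p02 p03 p13 p23 (hstrict (by decide))
    (hstrict (by decide)) (hstrict (by decide)) (hv0 1) (hv0 2) h0 h1 h2 h3 M1 M2 M3
    (hκ ⟨p01, p02, p03, p12, p13, p23⟩)
  exact ⟨hsv, s1, by rwa [t1], s2, by rwa [t2], s3, by rwa [t3]⟩

/-- The sufficiency of the arc conditions. -/
theorem IsGII.isDefinite_of_signs (hT : IsGII a₁ a₂ b c T₀ T₁ Tinf)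
    (hirr : IsIrreducibleTriple T₀ T₁ Tinf) (hH0 : H ≠ 0)
    (hH : IsInvariantHermitian T₀ T₁ Tinf H) {θ : Circle → ℝ}
    (hθ : ∀ z, θ z = orient (b⁻¹ * a₁⁻¹) z (b⁻¹ * a₂⁻¹)) {ε : ℝ}
    (h0 : 0 < ε * cotCoord b (c 0)) (h1 : 0 < ε * cotCoord b (c 1))
    (h2 : ¬ 0 < ε * cotCoord b (c 2)) (h3 : ¬ 0 < ε * cotCoord b (c 3))
    (s1 : 0 < θ b⁻¹ * θ (c 0 * c 1)) (s2 : 0 < θ b⁻¹ * θ (c 0 * c 2))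
    (s3 : ¬ 0 < θ b⁻¹ * θ (c 0 * c 3)) : IsDefinite H := by
  have hb1 : (b : ℂ) ≠ 1 := fun h => hT.b_ne_one (Circle.ext h)
  obtain ⟨v, hv⟩ : ∃ v : Fin 4 → ℝ, ∀ i, v i = cotCoord b (c i) := ⟨_, fun _ => rfl⟩
  simp only [← hv] at h0 h1 h2 h3
  obtain ⟨e₀₁, e₀₂, e₀₃, e₁₂, e₁₃, e₂₃, ⟨w0, w1, w2, w3⟩, hs, ht, ⟨-, -, n03⟩, hiff⟩ :=
    hT.exists_minors hirr hH0 hH hv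
  obtain ⟨hv0, hvinj, -, -, -, κ, hκ0, M1, M2, M3, D12, D13, D23, -⟩ :=
    real_moments hb1 hT.a₁_ne_a₂ (fun i => (hT.eigenvalue_inv_ne hirr i).1)
      (fun i => (hT.eigenvalue_inv_ne hirr i).2) hT.c_injective hT.det_relation hv hθ w0 w1 w2 w3
      hs ht
  obtain ⟨g1, g2, g3, -⟩ := opposite_minors_eq w0 w1 w2 w3
  have hε : ε ≠ 0 := left_ne_zero_of_mul h0.ne'
  have hε2 : 0 < ε * ε := mul_self_pos.mpr hε
  -- irreducibility keeps the remaining eigenvalues off the end points of the arcs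
  have h2' : ε * v 2 < 0 := lt_of_le_of_ne (not_lt.mp h2) (mul_ne_zero hε (hv0 2))
  have h3' : ε * v 3 < 0 := lt_of_le_of_ne (not_lt.mp h3) (mul_ne_zero hε (hv0 3))
  have hvs : ∀ i j, i ≠ j → v i - v j ≠ 0 := fun i j hij h => hij (hvinj (sub_eq_zero.mp h))
  have hθ3 : θ (c 0 * c 3) ≠ 0 := by
    intro h
    rw [h, mul_zero] at M3
    exact mul_ne_zero (mul_ne_zero hκ0 (mul_ne_zero (mul_ne_zero n03 (hv0 0)) (hv0 3)))
      (mul_ne_zero (mul_ne_zero (hvs 0 2 (by decide)) (hvs 1 3 (by decide)))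
        (mul_ne_zero (hvs 0 1 (by decide)) (hvs 2 3 (by decide)))) M3
  have hθb : θ b⁻¹ ≠ 0 := left_ne_zero_of_mul s1.ne'
  have hθb2 : 0 < θ b⁻¹ * θ b⁻¹ := mul_self_pos.mpr hθb
  have s3' : θ b⁻¹ * θ (c 0 * c 3) < 0 := lt_of_le_of_ne (not_lt.mp s3) (mul_ne_zero hθb hθ3)
  obtain ⟨s, p01, p02, p03, p12, p13, p23⟩ := minors_same_sign
    (by refine pos_of_mul_pos_right (a := ε * ε) ?_ hε2.le
        linarith [mul_pos h0 h1])
    (by refine pos_of_mul_pos_right (a := ε * ε) ?_ hε2.le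
        linarith [mul_pos_of_neg_of_neg h2' h3'])
    (by refine neg_of_mul_neg_right (a := ε * ε) ?_ hε2.le
        linarith [mul_neg_of_pos_of_neg h0 h2'])
    g1 g2 g3 hκ0 M1 M2 M3 D12 D13 D23
    (by refine pos_of_mul_pos_right (a := θ b⁻¹ * θ b⁻¹) ?_ hθb2.le
        linarith [mul_pos s1 s2])
    (by refine neg_of_mul_neg_right (a := θ b⁻¹ * θ b⁻¹) ?_ hθb2.le
        linarith [mul_neg_of_pos_of_neg s1 s3'])
  -- the minors sum to `1`, so their common sign is positive
  have hspos : 0 < s := by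
    have : s * (e₀₁ + e₀₂ + e₀₃ + e₁₂ + e₁₃ + e₂₃) = s := by rw [hs, mul_one]
    linarith
  exact hiff.mpr ⟨pos_of_mul_pos_right p01 hspos.le, pos_of_mul_pos_right p02 hspos.le,
    pos_of_mul_pos_right p03 hspos.le, pos_of_mul_pos_right p12 hspos.le,
    pos_of_mul_pos_right p13 hspos.le, pos_of_mul_pos_right p23 hspos.le⟩

/-- Only `c₁ c₂`, `c₁ c₃`, `c₁ c₄` matter for the second condition, since `θ` takes the same value at
complementary pairs. -/
theorem IsGII.isDefinite_iff (hT : IsGII a₁ a₂ b c T₀ T₁ Tinf)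
    (hirr : IsIrreducibleTriple T₀ T₁ Tinf) (hH0 : H ≠ 0)
    (hH : IsInvariantHermitian T₀ T₁ Tinf H) {I₁ I₂ : Set Circle} (hI₁ : IsOpenArc 1 b⁻¹ I₁)
    (hI₂ : IsOpenArc (b⁻¹ * a₁⁻¹) (b⁻¹ * a₂⁻¹) I₂) (hb : b⁻¹ ∈ I₂) :
    IsDefinite H ↔ ∃ σ : Equiv.Perm (Fin 4), ArcCondition I₁ I₂ (c ∘ σ) := by
  have hb1 : (b : ℂ) ≠ 1 := fun h => hT.b_ne_one (Circle.ext h)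
  obtain ⟨ε₁, hε₁, hI₁⟩ := hI₁.exists_sign
  obtain ⟨ε₂, hε₂, hI₂⟩ := hI₂.exists_sign
  obtain ⟨θ, hθ⟩ : ∃ θ : Circle → ℝ, ∀ z, θ z = orient (b⁻¹ * a₁⁻¹) z (b⁻¹ * a₂⁻¹) :=
    ⟨_, fun _ => rfl⟩
  have hmem₂ : ∀ z, z ∈ I₂ ↔ 0 < θ b⁻¹ * θ z := by
    intro z
    rw [hI₂, ← hθ] at hb
    rw [hI₂, ← hθ]
    rcases hε₂ with rfl | rfl
    · rw [one_mul] at hb ⊢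
      exact (mul_pos_iff_of_pos_left hb).symm
    · rw [neg_one_mul, neg_pos] at hb ⊢
      exact ⟨fun h => mul_pos_of_neg_of_neg hb h, fun h => neg_of_mul_pos_right h hb.le⟩
  have hmem₁ : ∀ i, c i ∈ I₁ ↔ 0 < ε₁ * cotCoord b (c i) := by
    intro i
    obtain ⟨r, hr, h⟩ := orient_one_eq_mul_cotCoord hb1 (hT.eigenvalue_inv_ne hirr i).1
    rw [hI₁, h, mul_left_comm]
    exact mul_pos_iff_of_pos_left hr
  simp only [ArcCondition, hmem₂, Function.comp_apply, hmem₁]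
  constructor
  · intro hdef
    obtain ⟨σ, hσ⟩ : ∃ σ : Equiv.Perm (Fin 4), Monotone ((fun i => cotCoord b (c i)) ∘ σ) :=
      ⟨_, Tuple.monotone_sort _⟩
    obtain ⟨⟨n0, n1, n2, n3⟩, p01, p23, p02, p13, p03, p12⟩ :=
      (hT.comp_perm σ).signs_of_isDefinite hirr hH0 hH hθ hσ hdef
    simp only [Function.comp_apply] at n0 n1 n2 n3 p01 p23 p02 p13 p03 p12
    rcases hε₁ with rfl | rfl
    · -- the arc contains the two largest coordinates: exchange the two pairs
      obtain ⟨τ, hτ⟩ : ∃ τ : Equiv.Perm (Fin 4), τ = σ * (Equiv.swap 0 2 * Equiv.swap 1 3) :=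
        ⟨_, rfl⟩
      have e0 : τ 0 = σ 2 := hτ ▸ rfl
      have e1 : τ 1 = σ 3 := hτ ▸ rfl
      have e2 : τ 2 = σ 0 := hτ ▸ rfl
      have e3 : τ 3 = σ 1 := hτ ▸ rfl
      refine ⟨τ, ?_⟩
      simp only [e0, e1, e2, e3, one_mul, not_lt]
      rw [mul_comm (c (σ 2)) (c (σ 0)), mul_comm (c (σ 3)) (c (σ 1)),
        mul_comm (c (σ 2)) (c (σ 1)), mul_comm (c (σ 3)) (c (σ 0))]
      exact ⟨⟨n2, n3, n0.le, n1.le⟩, p23, p01, p02, p13, p12.le, p03.le⟩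
    · refine ⟨σ, ?_⟩
      simp only [neg_one_mul, not_lt, neg_pos]
      exact ⟨⟨n0, n1, n2.le, n3.le⟩, p01, p23, p02, p13, p03.le, p12.le⟩
  · rintro ⟨σ, ⟨h0, h1, h2, h3⟩, s01, -, s02, -, s03, -⟩
    exact (hT.comp_perm σ).isDefinite_of_signs hirr hH0 hH hθ h0 h1 h2 h3 s01 s02 s03

end Definiteness

theorem mainTheorem2 (a₁ a₂ b : Circle) (c : Fin 4 → Circle)
    (T₀ T₁ Tinf : Matrix (Fin 4) (Fin 4) ℂ)
    (hT : IsGII a₁ a₂ b c T₀ T₁ Tinf)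
    (hirr : IsIrreducibleTriple T₀ T₁ Tinf) :
    (∃ H : Matrix (Fin 4) (Fin 4) ℂ, H ≠ 0 ∧ IsInvariantHermitian T₀ T₁ Tinf H ∧
      ∀ H' : Matrix (Fin 4) (Fin 4) ℂ, IsInvariantHermitian T₀ T₁ Tinf H' →
        ∃ r : ℝ, H' = (r : ℂ) • H) ∧
    ∀ H : Matrix (Fin 4) (Fin 4) ℂ, H ≠ 0 → IsInvariantHermitian T₀ T₁ Tinf H →
      ∀ I₁ I₂ : Set Circle, IsOpenArc 1 b⁻¹ I₁ →
        IsOpenArc (b⁻¹ * a₁⁻¹) (b⁻¹ * a₂⁻¹) I₂ → b⁻¹ ∈ I₂ →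
        (IsDefinite H ↔ ∃ σ : Equiv.Perm (Fin 4), ArcCondition I₁ I₂ (c ∘ σ)) := by
  refine ⟨?_, fun H hH0 hH I₁ I₂ hI₁ hI₂ hb => hT.isDefinite_iff hirr hH0 hH hI₁ hI₂ hb⟩
  obtain ⟨H, hH0, hH⟩ := hT.exists_hermitian hirr
  exact ⟨H, hH0, hH, fun H' hH' => hirr.hermitian_unique hT.prod_eq_one hH0 hH hH'⟩
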